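/- Let $n\ge 1$ and let $K\subset\mathbb R^n$ be a convex body, i.e. a compact convex set with non-empty interior. Write $|\cdot|$ for $n$-dimensional volume and $v_n$ for the volume of the Euclidean unit ball of $\mathbb R^n$. For $x\in K$ let $K^x=\{y\in\mathbb R^n:\langle y,z-x\rangle\le 1\text{ for all }z\in K\}$ be the polar body of $K$ with respect to $x$ (its volume may be $+\infty$), and for $t\in\mathbb R$ let $$S(K,t)=\Big\{x\in K:\ \frac{|K|\,|K^x|}{v_n^2}\le t\Big\}$$ be the Santaló region of $K$. For $v>0$ let the convex floating body $K_v$ be the set of all $x\in K$ such that $\langle x,u\rangle\le a$ for all unit vectors $u$ and all $a\in\mathbb R$ with $|\{z\in K:\langle z,u\rangle\ge a\}|=v$. Then: (i) $S(K,t)$ is strictly convex for all $t\in\mathbb R$. (ii) $S(A(K),t)=A(S(K,t))$ for every invertible affine transformation $A$ of $\mathbb R^n$ and all $t\in\mathbb R$. (iii) The boundary of $S(K,t)$ is $C^\infty$ for every $t$ for which $S(K,t)$ has more than one point; that is, near each of its boundary points $S(K,t)$ is a sublevel set $\{f\le 0\}$ of a $C^\infty$ function $f$ which vanishes at that point and whose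 derivative does not vanish there. (iv) The map $t\mapsto S(K,t)$ is increasing with respect to inclusion and concave, that is, for all $t,s\in\mathbb R$ and all $0\le\alpha\le 1$, $$S(K,\alpha t+(1-\alpha)s)\supseteq \alpha S(K,t)+(1-\alpha)S(K,s).$$ (v) For all $0<\delta<\tfrac12$, $\ K_{\delta|K|}\subseteq S\big(K,\tfrac{1}{4\delta(1-\delta)}\big)$. -/

import Mathlib

open MeasureTheory Set
open scoped ENNReal Pointwise ContDiff

/-- The polar body of `K` with respect to `x`: all `y` with `⟪y, z - x⟫ ≤ 1` for every `z ∈ K`. -/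
def polarAt {n : ℕ} (K : Set (EuclideanSpace ℝ (Fin n))) (x : EuclideanSpace ℝ (Fin n)) :
    Set (EuclideanSpace ℝ (Fin n)) :=
  {y | ∀ z ∈ K, inner ℝ y (z - x) ≤ 1}

/-- The Santaló region `S(K, t)`. Volumes take values in `[0, ∞]`, so a point at which the polar body
has infinite volume (a boundary point of a convex body) belongs to no Santaló region. -/
def santaloRegion {n : ℕ} (K : Set (EuclideanSpace ℝ (Fin n))) (t : ℝ) :
    Set (EuclideanSpace ℝ (Fin n)) :=
  {x | x ∈ K ∧
    volume K * volume (polarAt K x) /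
      volume (Metric.ball (0 : EuclideanSpace ℝ (Fin n)) 1) ^ 2 ≤ ENNReal.ofReal t}

/-- The convex floating body `K_v`: the part of `K` that remains in all the half-spaces
`{x | ⟪x, u⟫ ≤ a}` whose bounding hyperplane cuts off from `K` a cap `{x ∈ K | a ≤ ⟪x, u⟫}`
of volume exactly `v`. -/
def floatingBody {n : ℕ} (K : Set (EuclideanSpace ℝ (Fin n))) (v : ℝ) :
    Set (EuclideanSpace ℝ (Fin n)) :=
  {x | x ∈ K ∧ ∀ u : EuclideanSpace ℝ (Fin n), ‖u‖ = 1 → ∀ a : ℝ,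
    volume {z | z ∈ K ∧ a ≤ inner ℝ z u} = ENNReal.ofReal v → inner ℝ x u ≤ a}

/-- `S` has `C^∞` boundary: near each of its boundary points, `S` is the sublevel set `{f ≤ 0}` of a
smooth function `f` whose derivative does not vanish at that point. -/
def HasSmoothBoundary {n : ℕ} (S : Set (EuclideanSpace ℝ (Fin n))) : Prop :=
  ∀ x ∈ frontier S, ∃ (U : Set (EuclideanSpace ℝ (Fin n))) (f : EuclideanSpace ℝ (Fin n) → ℝ),
    IsOpen U ∧ x ∈ U ∧ ContDiffOn ℝ ∞ f U ∧ f x = 0 ∧ fderiv ℝ f x ≠ 0 ∧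
      S ∩ U = {y | y ∈ U ∧ f y ≤ 0}

/-! Everything except (ii) and (v) comes from one formula: for `x ∈ K`, `n! |K^x| = ∫ exp(⟪x, y⟫ -
h_K(y)) dy` with `h_K` the support function (`expMoment_mul_volume_polarAt`). The right side is a
Laplace transform. It is smooth and strictly convex on the interior of `K`, while `|K^x| = ∞` at
boundary points. Hence Santaló regions are closed sublevel sets of a smooth strictly convex function
`G` (`exists_santaloRegion_eq_sublevel`), which gives (i) and (iv). For (iii), a boundary point of a
region with a second point is not the strict minimiser of `G`, so the derivative of `G` is nonzero
there. Part (ii) is a change of variables in which the two determinants cancel.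

Part (v) rests on the Meyer–Pajor inequality (`exists_mem_hyperplane_volume_polarAt_le`): a
hyperplane `H` cutting `K` into parts of volumes `P`, `Q` contains `z ∈ K` with `4 P Q |K^z| ≤ |K|
v_n²`. If `x` lies in the floating body but not in the region, separation gives a hyperplane through
`x` missing the region. Both parts it cuts off have volume at least `δ|K|`, so `PQ ≥ δ(1-δ)|K|²` and
`z` belongs to the region, a contradiction.

The Meyer–Pajor inequality is obtained from functional inequalities by induction on dimension. The
line through the barycentres of the two parts meets `H` in `z`. Integrating along this direction
reduces each part to a centred function in one dimension less, the inner integrals being controlled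
by a half-line inequality that is Prékopa–Leindler in exponential coordinates. This gives
`FunctionalSantalo.split`. Applied to a halving hyperplane it drives the induction for the
functional Santaló inequality; applied to functions of the form `exp(-‖·‖²/2)` with the gauges of `K
- z` and its polar it gives Meyer–Pajor. -/

/-! ### One-dimensional Brunn–Minkowski and Prékopa–Leindler inequalities -/

/-- With `a = max A` and `b = min B`, the translates `A + b` and `a + B` meet only at `a + b`, and
both lie in `2C`. -/
theorem volume_add_volume_le_of_isCompact {A B C : Set ℝ} (hA : IsCompact A) (hB : IsCompact B)
    (hA0 : A.Nonempty) (hB0 : B.Nonempty) (h : ∀ s ∈ A, ∀ t ∈ B, (s + t) / 2 ∈ C) :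
    volume A + volume B ≤ 2 * volume C := by
  obtain ⟨a, haA, ha⟩ := hA.exists_isGreatest hA0
  obtain ⟨b, hbB, hb⟩ := hB.exists_isLeast hB0
  have key : volume (((fun x => x + b) '' A) ∪ ((fun x => a + x) '' B)) = volume A + volume B := by
    rw [measure_union₀ (hB.image (by fun_prop)).measurableSet.nullMeasurableSet]
    · congr 1
      · simp
      · simp
    · refine measure_mono_null (t := {a + b}) ?_ (by simp)
      rintro x ⟨⟨y, hy, rfl⟩, ⟨z, hz, hyz⟩⟩
      simp only [mem_singleton_iff] at *
      have := ha hy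
      have := hb hz
      linarith
  rw [← key]
  have : ((fun x => x + b) '' A) ∪ ((fun x => a + x) '' B) ⊆ (2 : ℝ) • C := by
    rintro x (⟨y, hy, rfl⟩ | ⟨y, hy, rfl⟩)
    · exact ⟨_, h y hy b hbB, by simp; ring⟩
    · exact ⟨_, h a haA y hy, by simp; ring⟩
  refine (measure_mono this).trans ?_
  rw [Measure.addHaar_smul]
  simp

/-- The one-dimensional Brunn–Minkowski inequality. -/
theorem volume_add_volume_le {A B C : Set ℝ} (hA : MeasurableSet A) (hB : MeasurableSet B)
    (hA0 : A.Nonempty) (hB0 : B.Nonempty) (h : ∀ s ∈ A, ∀ t ∈ B, (s + t) / 2 ∈ C) :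
    volume A + volume B ≤ 2 * volume C := by
  obtain ⟨a, ha⟩ := hA0
  obtain ⟨b, hb⟩ := hB0
  rw [hA.measure_eq_iSup_isCompact, hB.measure_eq_iSup_isCompact]
  simp only [iSup_and']
  refine ENNReal.biSup_add_biSup_le' (p := fun K => K ⊆ A ∧ IsCompact K)
    (q := fun K => K ⊆ B ∧ IsCompact K) ⟨∅, by simp⟩ ⟨∅, by simp⟩ ?_
  rintro K ⟨hKA, hK⟩ L ⟨hLB, hL⟩
  -- The approximating compact sets may be empty, so a point of `A` and a point of `B` are thrown
  -- in.
  refine le_trans (add_le_add (measure_mono (subset_insert a K)) (measure_mono (subset_insert b L)))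
    (volume_add_volume_le_of_isCompact (hK.insert a) (hL.insert b) ⟨a, by simp⟩ ⟨b, by simp⟩ ?_)
  intro s hs t ht
  exact h s (insert_subset ha hKA hs) t (insert_subset hb hLB ht)

theorem lintegral_eq_lintegral_Ioo_of_le_one {φ : ℝ → ℝ} (hφ : Measurable φ) (h0 : ∀ s, 0 ≤ φ s)
    (h1 : ∀ s, φ s ≤ 1) :
    ∫⁻ s, ENNReal.ofReal (φ s) = ∫⁻ r in Ioo (0 : ℝ) 1, volume {s | r < φ s} := by
  rw [lintegral_eq_lintegral_meas_lt _ (Filter.Eventually.of_forall h0) hφ.aemeasurable]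
  rw [← lintegral_indicator measurableSet_Ioi, ← lintegral_indicator measurableSet_Ioo]
  refine lintegral_congr fun x => ?_
  by_cases hx : x ∈ Ioo (0 : ℝ) 1
  · simp [hx, hx.1]
  rw [indicator_of_notMem hx]
  by_cases hx0 : x ∈ Ioi (0 : ℝ)
  swap
  · simp [indicator_of_notMem hx0]
  rw [indicator_of_mem hx0]
  have : {s | x < φ s} = ∅ := by
    ext s
    have := h1 s
    have h2 : ¬ x < 1 := fun h => hx ⟨hx0, h⟩
    simp only [mem_ofPred_eq, mem_empty_iff_false, iff_false]
    linarith
  simp [this]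

/-- Because both suprema equal 1, the level sets `{φ > r}` and `{ψ > r}` are nonempty for the same
range `0 < r < 1`. Brunn–Minkowski then applies level by level, and integration over `r` gives a sum
on the left. -/
theorem lintegral_add_le_of_iSup_eq_one {φ ψ h : ℝ → ℝ} (hφ : Measurable φ) (hψ : Measurable ψ)
    (hh : Measurable h) (hφ0 : ∀ s, 0 ≤ φ s) (hψ0 : ∀ s, 0 ≤ ψ s) (hh0 : ∀ s, 0 ≤ h s)
    (hφ1 : IsLUB (range φ) 1) (hψ1 : IsLUB (range ψ) 1)
    (H : ∀ s t, φ s * ψ t ≤ h ((s + t) / 2) ^ 2) :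
    (∫⁻ s, ENNReal.ofReal (φ s)) + ∫⁻ s, ENNReal.ofReal (ψ s) ≤ 2 * ∫⁻ s, ENNReal.ofReal (h s) := by
  rw [lintegral_eq_lintegral_Ioo_of_le_one hφ hφ0 fun s => hφ1.1 ⟨s, rfl⟩,
    lintegral_eq_lintegral_Ioo_of_le_one hψ hψ0 fun s => hψ1.1 ⟨s, rfl⟩,
    lintegral_eq_lintegral_meas_lt _ (Filter.Eventually.of_forall hh0) hh.aemeasurable]
  have anti : ∀ f : ℝ → ℝ, Measurable fun r : ℝ => volume {s | r < f s} := fun f =>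
    Antitone.measurable fun a b hab => measure_mono fun s hs => lt_of_le_of_lt hab hs
  rw [← lintegral_add_left (anti φ), ← lintegral_const_mul _ (anti h)]
  refine (setLIntegral_mono ((anti h).const_mul _) ?_).trans
    (lintegral_mono_set fun x hx => hx.1)
  intro r hr
  obtain ⟨_, ⟨s, rfl⟩, hs⟩ := (lt_isLUB_iff hφ1).1 hr.2
  obtain ⟨_, ⟨t, rfl⟩, ht⟩ := (lt_isLUB_iff hψ1).1 hr.2
  refine volume_add_volume_le (measurableSet_lt measurable_const hφ)
    (measurableSet_lt measurable_const hψ) ⟨s, hs⟩ ⟨t, ht⟩ ?_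
  intro s hs t ht
  simp only [mem_ofPred_eq] at *
  have := H s t
  have h3 : r ^ 2 < h ((s + t) / 2) ^ 2 := by
    have := hr.1
    nlinarith
  exact lt_of_pow_lt_pow_left₀ 2 (hh0 _) h3

/-- The one-dimensional Prékopa–Leindler inequality for the geometric mean, bounded case. -/
theorem lintegral_mul_le_sq_of_bounded {φ ψ h : ℝ → ℝ} (hφ : Measurable φ) (hψ : Measurable ψ)
    (hh : Measurable h) (hφ0 : ∀ s, 0 ≤ φ s) (hψ0 : ∀ s, 0 ≤ ψ s) (hh0 : ∀ s, 0 ≤ h s)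
    (hφ1 : BddAbove (range φ)) (hψ1 : BddAbove (range ψ))
    (H : ∀ s t, φ s * ψ t ≤ h ((s + t) / 2) ^ 2) :
    (∫⁻ s, ENNReal.ofReal (φ s)) * ∫⁻ s, ENNReal.ofReal (ψ s)
      ≤ (∫⁻ s, ENNReal.ofReal (h s)) ^ 2 := by
  obtain ⟨M, hM⟩ := Real.exists_isLUB (range_nonempty φ) hφ1
  obtain ⟨N, hN⟩ := Real.exists_isLUB (range_nonempty ψ) hψ1
  have hM0 : 0 ≤ M := (hφ0 0).trans (hM.1 ⟨0, rfl⟩)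
  have hN0 : 0 ≤ N := (hψ0 0).trans (hN.1 ⟨0, rfl⟩)
  rcases hM0.eq_or_lt with rfl | hM0
  · have : ∀ s, ENNReal.ofReal (φ s) = 0 := fun s => ENNReal.ofReal_eq_zero.2 (hM.1 ⟨s, rfl⟩)
    simp [this]
  rcases hN0.eq_or_lt with rfl | hN0
  · have : ∀ s, ENNReal.ofReal (ψ s) = 0 := fun s => ENNReal.ofReal_eq_zero.2 (hN.1 ⟨s, rfl⟩)
    simp [this]
  have lub : ∀ {f : ℝ → ℝ} {P : ℝ}, 0 < P → IsLUB (range f) P →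
      IsLUB (range fun s => P⁻¹ * f s) 1 := by
    intro f P hP hf
    constructor
    · rintro _ ⟨s, rfl⟩
      have := hf.1 ⟨s, rfl⟩
      simpa [hP.ne'] using mul_le_mul_of_nonneg_left this (inv_nonneg.2 hP.le)
    · intro b hb
      have : P ≤ P * b := hf.2 (by
        rintro _ ⟨s, rfl⟩
        have := hb ⟨s, rfl⟩
        simp only at this
        rwa [inv_mul_le_iff₀ hP] at this)
      nlinarith
  -- Dividing `φ`, `ψ`, `h` by `M`, `N`, `√(MN)` preserves the pointwise hypothesis and normalises
  -- the suprema; the product bound then follows from the sum bound by `4xy ≤ (x + y)²`.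
  set Q := Real.sqrt (M * N) with hQ
  have hQ0 : 0 < Q := Real.sqrt_pos.2 (mul_pos hM0 hN0)
  have hQ2 : Q ^ 2 = M * N := Real.sq_sqrt (mul_pos hM0 hN0).le
  have key := lintegral_add_le_of_iSup_eq_one (hφ.const_mul M⁻¹) (hψ.const_mul N⁻¹)
    (hh.const_mul Q⁻¹) (fun s => mul_nonneg (inv_nonneg.2 hM0.le) (hφ0 s))
    (fun s => mul_nonneg (inv_nonneg.2 hN0.le) (hψ0 s))
    (fun s => mul_nonneg (inv_nonneg.2 hQ0.le) (hh0 s)) (lub hM0 hM) (lub hN0 hN) (by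
      intro s t
      have : (Q⁻¹ * h ((s + t) / 2)) ^ 2 = (M * N)⁻¹ * h ((s + t) / 2) ^ 2 := by
        rw [mul_pow, inv_pow, hQ2]
      rw [this]
      calc M⁻¹ * φ s * (N⁻¹ * ψ t) = (M * N)⁻¹ * (φ s * ψ t) := by rw [mul_inv]; ring
        _ ≤ _ := mul_le_mul_of_nonneg_left (H s t) (by positivity))
  have pull : ∀ {f : ℝ → ℝ} {P : ℝ}, 0 < P → ∫⁻ s, ENNReal.ofReal (P⁻¹ * f s) =
      ENNReal.ofReal P⁻¹ * ∫⁻ s, ENNReal.ofReal (f s) := by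
    intro f P hP
    simp_rw [ENNReal.ofReal_mul (inv_nonneg.2 hP.le)]
    rw [lintegral_const_mul' _ _ ENNReal.ofReal_ne_top]
  rw [pull hM0, pull hN0, pull hQ0] at key
  generalize (∫⁻ s, ENNReal.ofReal (φ s)) = X at key ⊢
  generalize (∫⁻ s, ENNReal.ofReal (ψ s)) = Y at key ⊢
  generalize (∫⁻ s, ENNReal.ofReal (h s)) = Z at key ⊢
  rcases eq_or_ne Z ⊤ with hZ | hZ
  · simp [hZ]
  have hR : ENNReal.ofReal Q⁻¹ * Z ≠ ⊤ := ENNReal.mul_ne_top ENNReal.ofReal_ne_top hZ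
  have hX : X ≠ ⊤ := by
    rintro hX
    rw [hX, ENNReal.mul_top (by simpa using hM0)] at key
    simp at key
    exact ENNReal.mul_ne_top (by simp) hR key
  have hY : Y ≠ ⊤ := by
    rintro hY
    rw [hY, ENNReal.mul_top (by simpa using hN0)] at key
    simp at key
    exact ENNReal.mul_ne_top (by simp) hR key
  lift X to NNReal using hX
  lift Y to NNReal using hY
  lift Z to NNReal using hZ
  have key' : (M⁻¹ * X + N⁻¹ * Y : ℝ) ≤ 2 * (Q⁻¹ * Z) := by
    have := ENNReal.toReal_mono (ENNReal.mul_ne_top (by simp) hR) key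
    rw [ENNReal.toReal_add (ENNReal.mul_ne_top (by simp) (by simp))
      (ENNReal.mul_ne_top (by simp) (by simp))] at this
    simpa [ENNReal.toReal_mul, hM0.le, hN0.le, hQ0.le] using this
  have e : (X * Y : ℝ) ≤ (Z : ℝ) ^ 2 := by
    have h1 : 4 * ((M⁻¹ * X) * (N⁻¹ * Y) : ℝ) ≤ (2 * (Q⁻¹ * Z)) ^ 2 := by
      have hx : 0 ≤ (M⁻¹ * X : ℝ) := by positivity
      have hy : 0 ≤ (N⁻¹ * Y : ℝ) := by positivity
      calc 4 * ((M⁻¹ * X) * (N⁻¹ * Y) : ℝ) ≤ (M⁻¹ * X + N⁻¹ * Y : ℝ) ^ 2 := by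
            nlinarith [sq_nonneg (M⁻¹ * X - N⁻¹ * Y : ℝ)]
        _ ≤ _ := pow_le_pow_left₀ (by positivity) key' 2
    have h2 : (2 * (Q⁻¹ * Z : ℝ)) ^ 2 = 4 * ((M * N)⁻¹ * Z ^ 2) := by
      rw [← hQ2]; field_simp; ring
    have h3 : 4 * ((M⁻¹ * X) * (N⁻¹ * Y) : ℝ) = 4 * ((M * N)⁻¹ * (X * Y)) := by
      rw [mul_inv]; ring
    rw [h2, h3] at h1
    have hp : 0 < (M * N)⁻¹ := by positivity
    nlinarith
  exact_mod_cast e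

/-- The one-dimensional Prékopa–Leindler inequality for the geometric mean. -/
theorem lintegral_mul_le_sq {φ ψ : ℝ → ℝ≥0∞} {h : ℝ → ℝ} (hφ : Measurable φ) (hψ : Measurable ψ)
    (hh : Measurable h) (hh0 : ∀ s, 0 ≤ h s)
    (H : ∀ s t, φ s * ψ t ≤ ENNReal.ofReal (h ((s + t) / 2) ^ 2)) :
    (∫⁻ s, φ s) * ∫⁻ s, ψ s ≤ (∫⁻ s, ENNReal.ofReal (h s)) ^ 2 := by
  have trunc : ∀ f : ℝ → ℝ≥0∞, Measurable f →
      ∫⁻ s, f s = ⨆ k : ℕ, ∫⁻ s, min (f s) k := by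
    intro f hf
    rw [← lintegral_iSup (fun k => hf.min measurable_const)
      (fun k l hkl s => min_le_min_left _ (by exact_mod_cast hkl))]
    congr 1
    ext s
    rw [← inf_iSup_eq, ENNReal.iSup_natCast]
    simp
  rw [trunc φ hφ, trunc ψ hψ]
  simp only [ENNReal.iSup_mul, ENNReal.mul_iSup, iSup_le_iff]
  intro k l
  have fin : ∀ (f : ℝ → ℝ≥0∞) (k : ℕ) s, min (f s) k ≠ ⊤ := fun f k s =>
    ne_top_of_le_ne_top (ENNReal.natCast_ne_top k) (min_le_right _ _)
  have e : ∀ (f : ℝ → ℝ≥0∞) (k : ℕ), ∫⁻ s, min (f s) k =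
      ∫⁻ s, ENNReal.ofReal (min (f s) k).toReal := fun f k =>
    lintegral_congr fun s => (ENNReal.ofReal_toReal (fin f k s)).symm
  rw [e, e]
  have bdd : ∀ (f : ℝ → ℝ≥0∞) (k : ℕ), BddAbove (range fun s => (min (f s) k).toReal) := by
    intro f k
    refine ⟨k, ?_⟩
    rintro _ ⟨s, rfl⟩
    have := ENNReal.toReal_mono (ENNReal.natCast_ne_top k) (min_le_right (f s) (k : ℝ≥0∞))
    simpa using this
  refine lintegral_mul_le_sq_of_bounded (hφ.min measurable_const).ennreal_toReal
    (hψ.min measurable_const).ennreal_toReal hh (fun s => ENNReal.toReal_nonneg)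
    (fun s => ENNReal.toReal_nonneg) hh0 (bdd _ _) (bdd _ _) ?_
  intro s t
  rw [← ENNReal.toReal_mul]
  refine ENNReal.toReal_le_of_le_ofReal (sq_nonneg _) (le_trans ?_ (H s t))
  exact mul_le_mul' (min_le_left _ _) (min_le_left _ _)

theorem lintegral_Ioi_eq_lintegral_exp (f : ℝ → ℝ≥0∞) :
    ∫⁻ s in Ioi (0 : ℝ), f s = ∫⁻ s, ENNReal.ofReal (Real.exp s) * f (Real.exp s) := by
  have := lintegral_image_eq_lintegral_abs_deriv_mul (s := univ) (f := Real.exp)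
    (f' := Real.exp) MeasurableSet.univ (fun x _ => (Real.hasDerivAt_exp x).hasDerivWithinAt)
    Real.exp_injective.injOn f
  rw [image_univ, Real.range_exp] at this
  simpa using this

/-- A Blaschke–Santaló inequality on the half-line. -/
theorem lintegral_Ioi_mul_lintegral_Ioi_le {φ ψ : ℝ → ℝ≥0∞} (hφ : Measurable φ) (hψ : Measurable ψ)
    {C : ℝ} (hC : 0 ≤ C)
    (H : ∀ s t, 0 < s → 0 < t → φ s * ψ t ≤ ENNReal.ofReal (C * Real.exp (-(s * t)))) :
    (∫⁻ s in Ioi (0 : ℝ), φ s) * ∫⁻ s in Ioi (0 : ℝ), ψ s ≤ ENNReal.ofReal (C * (Real.pi / 2)) := by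
  have hI : ∫⁻ s in Ioi (0 : ℝ), ENNReal.ofReal (Real.sqrt C * Real.exp (-(1 / 2) * s ^ 2)) =
      ENNReal.ofReal (Real.sqrt C * (Real.sqrt (Real.pi / (1 / 2)) / 2)) := by
    rw [← integral_gaussian_Ioi, ← integral_const_mul, ofReal_integral_eq_lintegral_ofReal]
    · exact ((integrable_exp_neg_mul_sq (by norm_num)).integrableOn).const_mul _
    · exact Filter.Eventually.of_forall fun s => by positivity
  -- In coordinates `exp s`, the midpoint of exponents is the geometric mean of the variables, and
  -- `√C exp(-r²/2)` at `r² = st` has square `C exp(-st)`. The extra factor `exp s` is the Jacobian.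
  have key := lintegral_mul_le_sq (φ := fun s => ENNReal.ofReal (Real.exp s) * φ (Real.exp s))
    (ψ := fun s => ENNReal.ofReal (Real.exp s) * ψ (Real.exp s))
    (h := fun s => Real.exp s * (Real.sqrt C * Real.exp (-(1 / 2) * Real.exp s ^ 2)))
    (by fun_prop) (by fun_prop) (by fun_prop) (fun s => by positivity) (by
      intro s t
      have := H (Real.exp s) (Real.exp t) (Real.exp_pos _) (Real.exp_pos _)
      calc _ = ENNReal.ofReal (Real.exp s * Real.exp t) * (φ (Real.exp s) * ψ (Real.exp t)) := by
            rw [ENNReal.ofReal_mul (Real.exp_pos _).le]; ring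
        _ ≤ ENNReal.ofReal (Real.exp s * Real.exp t) *
            ENNReal.ofReal (C * Real.exp (-(Real.exp s * Real.exp t))) := by gcongr
        _ = _ := by
            rw [← ENNReal.ofReal_mul (by positivity)]
            congr 1
            have e2 : Real.exp ((s + t) / 2) ^ 2 = Real.exp s * Real.exp t := by
              rw [← Real.exp_nat_mul, ← Real.exp_add]; congr 1; push_cast; ring
            rw [mul_pow, mul_pow, e2, Real.sq_sqrt hC, ← Real.exp_nat_mul]
            congr 3
            push_cast; ring)
  rw [lintegral_Ioi_eq_lintegral_exp, lintegral_Ioi_eq_lintegral_exp]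
  refine key.trans ?_
  have : ∫⁻ s, ENNReal.ofReal (Real.exp s * (Real.sqrt C * Real.exp (-(1 / 2) * Real.exp s ^ 2))) =
      ENNReal.ofReal (Real.sqrt C * (Real.sqrt (Real.pi / (1 / 2)) / 2)) := by
    rw [← hI, lintegral_Ioi_eq_lintegral_exp]
    exact lintegral_congr fun s => ENNReal.ofReal_mul (Real.exp_pos _).le
  rw [this, ← ENNReal.ofReal_pow (by positivity)]
  apply ENNReal.ofReal_le_ofReal
  rw [mul_pow, div_pow, Real.sq_sqrt hC, Real.sq_sqrt (by positivity)]
  apply le_of_eq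
  ring

/-! ### The functional Santaló inequality by induction on dimension -/

/-- A nonnegative function whose first moments are finite and vanish. -/
structure IsCentered {n : ℕ} (f : EuclideanSpace ℝ (Fin n) → ℝ≥0∞) : Prop where
  measurable : Measurable f
  moment_eq (ℓ : EuclideanSpace ℝ (Fin n)) :
    ∫⁻ x, ENNReal.ofReal (inner ℝ ℓ x) * f x = ∫⁻ x, ENNReal.ofReal (-inner ℝ ℓ x) * f x
  moment_ne_top (ℓ : EuclideanSpace ℝ (Fin n)) :
    ∫⁻ x, ENNReal.ofReal (inner ℝ ℓ x) * f x ≠ ⊤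

/-- The functional Blaschke–Santaló inequality in dimension `n`. -/
def FunctionalSantalo (n : ℕ) : Prop :=
  ∀ f g : EuclideanSpace ℝ (Fin n) → ℝ≥0∞, IsCentered f → Measurable g →
    (∀ x y, f x * g y ≤ ENNReal.ofReal (Real.exp (-inner ℝ x y))) →
    (∫⁻ x, f x) * ∫⁻ y, g y ≤ ENNReal.ofReal ((2 * Real.pi) ^ n)

/-- Fibres the half-space by rays parallel to `(w, 1)`; for fixed height the shear is a translation,
so volume is preserved. -/
theorem setLIntegral_upper_half_shear {m : ℕ} (w : EuclideanSpace ℝ (Fin m))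
    {φ : EuclideanSpace ℝ (Fin m) × ℝ → ℝ≥0∞} (hφ : Measurable φ) :
    ∫⁻ p in {p | 0 < p.2}, φ p = ∫⁻ y, ∫⁻ s in Ioi (0 : ℝ), φ (y + s • w, s) := by
  have : {p : EuclideanSpace ℝ (Fin m) × ℝ | 0 < p.2} = univ ×ˢ Ioi 0 := by
    ext p; simp
  rw [this, Measure.volume_eq_prod, ← Measure.prod_restrict, Measure.restrict_univ,
    lintegral_prod_symm _ hφ.aemeasurable, lintegral_lintegral_swap (f := fun y s => φ (y + s • w, s))
      (by fun_prop)]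
  refine lintegral_congr fun s => ?_
  rw [lintegral_add_right_eq_self (fun y => φ (y, s))]

/-- The shear dual to the previous one: together they turn the pairing into `⟪y + s w, x⟫ + s (t -
⟪w, x⟫) = ⟪y, x⟫ + s t`, which separates the two variables. -/
theorem setLIntegral_dual_half_shear {m : ℕ} (w : EuclideanSpace ℝ (Fin m))
    {φ : EuclideanSpace ℝ (Fin m) × ℝ → ℝ≥0∞} (hφ : Measurable φ) :
    ∫⁻ p in {p | 0 < p.2 + inner ℝ w p.1}, φ p =
      ∫⁻ x, ∫⁻ t in Ioi (0 : ℝ), φ (x, t - inner ℝ w x) := by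
  have hm : MeasurableSet {p : EuclideanSpace ℝ (Fin m) × ℝ | 0 < p.2 + inner ℝ w p.1} :=
    measurableSet_lt measurable_const (by fun_prop)
  rw [← lintegral_indicator hm, Measure.volume_eq_prod, lintegral_prod _ (hφ.indicator hm).aemeasurable]
  refine lintegral_congr fun x => ?_
  rw [← lintegral_indicator measurableSet_Ioi,
    ← lintegral_sub_right_eq_self _ (inner ℝ w x)]
  refine lintegral_congr fun t => ?_
  simp [indicator, sub_add_cancel]

/-- After the two shears, the half-line inequality bounds the product of the fibre integrals `F`,
`G` pointwise by `(π/2) exp(-⟪x, y⟫)`. The moment hypothesis says that `F` is centred, so the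
`m`-dimensional inequality applies to `F` and `G / (π/2)`. The constant is `(π/2)(2π)^m =
(2π)^(m+1)/4`. -/
theorem FunctionalSantalo.upper_half_le {m : ℕ} (hB : FunctionalSantalo m)
    {f g : EuclideanSpace ℝ (Fin m) × ℝ → ℝ≥0∞} (hf : Measurable f) (hg : Measurable g)
    (H : ∀ p q, f p * g q ≤ ENNReal.ofReal (Real.exp (-(inner ℝ p.1 q.1 + p.2 * q.2))))
    (w : EuclideanSpace ℝ (Fin m))
    (hw : ∀ ℓ : EuclideanSpace ℝ (Fin m),
      ∫⁻ p in {p | 0 < p.2}, ENNReal.ofReal (inner ℝ ℓ (p.1 - p.2 • w)) * f p =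
        ∫⁻ p in {p | 0 < p.2}, ENNReal.ofReal (-inner ℝ ℓ (p.1 - p.2 • w)) * f p)
    (hw' : ∀ ℓ : EuclideanSpace ℝ (Fin m),
      ∫⁻ p in {p | 0 < p.2}, ENNReal.ofReal (inner ℝ ℓ (p.1 - p.2 • w)) * f p ≠ ⊤) :
    (∫⁻ p in {p | 0 < p.2}, f p) * ∫⁻ q in {q | 0 < q.2 + inner ℝ w q.1}, g q ≤
      ENNReal.ofReal ((2 * Real.pi) ^ (m + 1) / 4) := by
  set F : EuclideanSpace ℝ (Fin m) → ℝ≥0∞ := fun y => ∫⁻ s in Ioi (0 : ℝ), f (y + s • w, s) with hF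
  set G : EuclideanSpace ℝ (Fin m) → ℝ≥0∞ :=
    fun x => ∫⁻ t in Ioi (0 : ℝ), g (x, t - inner ℝ w x) with hG
  have hFm : Measurable F := by
    refine Measurable.lintegral_prod_right' (f := fun p : EuclideanSpace ℝ (Fin m) × ℝ =>
      f (p.1 + p.2 • w, p.2)) ?_
    fun_prop
  have hGm : Measurable G := by
    refine Measurable.lintegral_prod_right' (f := fun p : EuclideanSpace ℝ (Fin m) × ℝ =>
      g (p.1, p.2 - inner ℝ w p.1)) ?_
    fun_prop
  have mom : ∀ θ : EuclideanSpace ℝ (Fin m) → ℝ≥0∞, Measurable θ →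
      ∫⁻ y, θ y * F y = ∫⁻ p in {p | 0 < p.2}, θ (p.1 - p.2 • w) * f p := by
    intro θ hθ
    rw [setLIntegral_upper_half_shear w (by fun_prop)]
    refine lintegral_congr fun y => ?_
    rw [hF, ← lintegral_const_mul _ (by fun_prop)]
    refine lintegral_congr fun s => ?_
    simp
  have cen : IsCentered F := by
    refine ⟨hFm, fun ℓ => ?_, fun ℓ => ?_⟩
    · rw [mom _ (by fun_prop), mom (fun y => ENNReal.ofReal (-inner ℝ ℓ y)) (by fun_prop)]
      exact hw ℓ
    · rw [mom _ (by fun_prop)]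
      exact hw' ℓ
  have pw : ∀ x y, F x * G y ≤ ENNReal.ofReal (Real.exp (-inner ℝ x y) * (Real.pi / 2)) := by
    intro x y
    refine lintegral_Ioi_mul_lintegral_Ioi_le (by fun_prop) (by fun_prop) (Real.exp_pos _).le ?_
    intro s t _ _
    refine (H _ _).trans (ENNReal.ofReal_le_ofReal ?_)
    rw [← Real.exp_add]
    apply le_of_eq
    congr 1
    simp only [inner_add_left, inner_smul_left, RCLike.conj_to_real]
    ring
  have hpi : (0 : ℝ) < Real.pi / 2 := by positivity
  have hpiE : ENNReal.ofReal (Real.pi / 2) ≠ 0 := by simpa using hpi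
  have := hB F (fun y => (ENNReal.ofReal (Real.pi / 2))⁻¹ * G y) cen (by fun_prop) (by
    intro x y
    calc F x * ((ENNReal.ofReal (Real.pi / 2))⁻¹ * G y)
        = (ENNReal.ofReal (Real.pi / 2))⁻¹ * (F x * G y) := by ring
      _ ≤ (ENNReal.ofReal (Real.pi / 2))⁻¹ *
          ENNReal.ofReal (Real.exp (-inner ℝ x y) * (Real.pi / 2)) := by gcongr; exact pw x y
      _ = _ := by
        rw [mul_comm (Real.exp _), ENNReal.ofReal_mul hpi.le, ← mul_assoc,
          ENNReal.inv_mul_cancel hpiE ENNReal.ofReal_ne_top, one_mul])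
  rw [lintegral_const_mul _ hGm] at this
  rw [setLIntegral_upper_half_shear w hf, setLIntegral_dual_half_shear w hg]
  change (∫⁻ x, F x) * ∫⁻ y, G y ≤ _
  calc (∫⁻ x, F x) * ∫⁻ y, G y
      = ENNReal.ofReal (Real.pi / 2) *
        ((∫⁻ x, F x) * ((ENNReal.ofReal (Real.pi / 2))⁻¹ * ∫⁻ y, G y)) := by
        rw [mul_left_comm, ← mul_assoc (ENNReal.ofReal (Real.pi / 2)),
          ENNReal.mul_inv_cancel hpiE ENNReal.ofReal_ne_top, one_mul]
    _ ≤ ENNReal.ofReal (Real.pi / 2) * ENNReal.ofReal ((2 * Real.pi) ^ m) := by gcongr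
    _ = _ := by
        rw [← ENNReal.ofReal_mul hpi.le]
        congr 1
        ring

theorem setLIntegral_comp_prod_neg {m : ℕ} {S T : Set (EuclideanSpace ℝ (Fin m) × ℝ)}
    (φ : EuclideanSpace ℝ (Fin m) × ℝ → ℝ≥0∞)
    (h : ∀ p, p ∈ T ↔ (p.1, -p.2) ∈ S) :
    ∫⁻ p in T, φ (p.1, -p.2) = ∫⁻ p in S, φ p := by
  have mp : MeasurePreserving (fun p : EuclideanSpace ℝ (Fin m) × ℝ => (p.1, -p.2)) :=
    (MeasurePreserving.id volume).prod (Measure.measurePreserving_neg volume)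
  have he : MeasurableEmbedding (fun p : EuclideanSpace ℝ (Fin m) × ℝ => (p.1, -p.2)) :=
    ((MeasurableEquiv.refl _).prodCongr (MeasurableEquiv.neg ℝ)).measurableEmbedding
  have : T = (fun p : EuclideanSpace ℝ (Fin m) × ℝ => (p.1, -p.2)) ⁻¹' S := by
    ext p; exact h p
  rw [this, mp.setLIntegral_comp_preimage_emb he]

/-- Reflecting the last coordinate exchanges the halves and replaces `w` by `-w`. -/
theorem FunctionalSantalo.lower_half_le {m : ℕ} (hB : FunctionalSantalo m)
    {f g : EuclideanSpace ℝ (Fin m) × ℝ → ℝ≥0∞} (hf : Measurable f) (hg : Measurable g)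
    (H : ∀ p q, f p * g q ≤ ENNReal.ofReal (Real.exp (-(inner ℝ p.1 q.1 + p.2 * q.2))))
    (w : EuclideanSpace ℝ (Fin m))
    (hw : ∀ ℓ : EuclideanSpace ℝ (Fin m),
      ∫⁻ p in {p | p.2 < 0}, ENNReal.ofReal (inner ℝ ℓ (p.1 - p.2 • w)) * f p =
        ∫⁻ p in {p | p.2 < 0}, ENNReal.ofReal (-inner ℝ ℓ (p.1 - p.2 • w)) * f p)
    (hw' : ∀ ℓ : EuclideanSpace ℝ (Fin m),
      ∫⁻ p in {p | p.2 < 0}, ENNReal.ofReal (inner ℝ ℓ (p.1 - p.2 • w)) * f p ≠ ⊤) :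
    (∫⁻ p in {p | p.2 < 0}, f p) * ∫⁻ q in {q | q.2 + inner ℝ w q.1 < 0}, g q ≤
      ENNReal.ofReal ((2 * Real.pi) ^ (m + 1) / 4) := by
  have hS : ∀ p : EuclideanSpace ℝ (Fin m) × ℝ, p ∈ {p : EuclideanSpace ℝ (Fin m) × ℝ | 0 < p.2} ↔
      (p.1, -p.2) ∈ {p : EuclideanSpace ℝ (Fin m) × ℝ | p.2 < 0} := by simp
  have := hB.upper_half_le (f := fun p => f (p.1, -p.2)) (g := fun p => g (p.1, -p.2))
    (by fun_prop) (by fun_prop) (fun p q => by simpa using H (p.1, -p.2) (q.1, -q.2)) (-w)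
    (fun ℓ => by
      have e1 := setLIntegral_comp_prod_neg
        (fun p => ENNReal.ofReal (inner ℝ ℓ (p.1 - p.2 • w)) * f p) hS
      have e2 := setLIntegral_comp_prod_neg
        (fun p => ENNReal.ofReal (-inner ℝ ℓ (p.1 - p.2 • w)) * f p) hS
      simp only [neg_smul, smul_neg] at e1 e2 ⊢
      rw [e1, e2, hw ℓ])
    (fun ℓ => by
      have e1 := setLIntegral_comp_prod_neg
        (fun p => ENNReal.ofReal (inner ℝ ℓ (p.1 - p.2 • w)) * f p) hS
      simp only [neg_smul, smul_neg] at e1 ⊢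
      rw [e1]
      exact hw' ℓ)
  rw [setLIntegral_comp_prod_neg f hS, setLIntegral_comp_prod_neg g
    (S := {q | q.2 + inner ℝ w q.1 < 0}) (fun p => by
      simp only [mem_ofPred_eq, inner_neg_left]
      constructor <;> intro h <;> linarith)] at this
  exact this

theorem volume_inner_eq_zero {n : ℕ} {v : EuclideanSpace ℝ (Fin n)} (hv : v ≠ 0) :
    volume {q | inner ℝ q v = 0} = 0 := by
  have : {q | inner ℝ q v = 0} = ((ℝ ∙ v)ᗮ : Submodule ℝ (EuclideanSpace ℝ (Fin n))) := by
    ext q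
    simp [Submodule.mem_orthogonal_singleton_iff_inner_left]
  rw [this]
  refine Measure.addHaar_submodule _ _ fun h => hv ?_
  have h2 : v ∈ (ℝ ∙ v)ᗮ := h ▸ Submodule.mem_top
  rw [Submodule.mem_orthogonal_singleton_iff_inner_left] at h2
  exact inner_self_eq_zero.1 h2

theorem volume_inner_eq {n : ℕ} {v : EuclideanSpace ℝ (Fin n)} (hv : v ≠ 0) (a : ℝ) :
    volume {q | inner ℝ q v = a} = 0 := by
  have hv2 : (inner ℝ v v : ℝ) ≠ 0 := fun h => hv (inner_self_eq_zero.1 h)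
  have : {q | inner ℝ q v = a} =
      (fun q => q + -((a / inner ℝ v v) • v)) ⁻¹' {q | inner ℝ q v = 0} := by
    ext q
    simp only [mem_ofPred_eq, mem_preimage, inner_add_left, inner_neg_left, inner_smul_left,
      RCLike.conj_to_real, div_mul_cancel₀ _ hv2]
    constructor <;> intro h <;> linarith
  rw [this, measure_preimage_add_right, volume_inner_eq_zero hv]

theorem lintegral_eq_add_of_hyperplane {n : ℕ} {v : EuclideanSpace ℝ (Fin n)} (hv : v ≠ 0) (a : ℝ)
    (g : EuclideanSpace ℝ (Fin n) → ℝ≥0∞) :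
    ∫⁻ q, g q = (∫⁻ q in {q | a < inner ℝ q v}, g q) + ∫⁻ q in {q | inner ℝ q v < a}, g q := by
  have hP : MeasurableSet {q | inner ℝ q v < a} :=
    measurableSet_lt (by fun_prop) measurable_const
  have hP' : MeasurableSet {q | a < inner ℝ q v} :=
    measurableSet_lt measurable_const (by fun_prop)
  rw [← lintegral_union hP]
  · rw [← setLIntegral_univ]
    refine setLIntegral_congr ?_
    symm
    rw [Filter.eventuallyEq_univ, mem_ae_iff]
    refine measure_mono_null ?_ (volume_inner_eq hv a)
    intro q hq
    simp only [mem_compl_iff, mem_union, mem_ofPred_eq, not_or, not_lt] at hq ⊢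
    exact le_antisymm hq.1 hq.2
  · refine disjoint_left.2 fun q hq hq' => ?_
    simp only [mem_ofPred_eq] at hq hq'
    linarith

/-- Orthogonal coordinates in which `⟪·, u⟫` is the last coordinate. -/
theorem exists_coordinates {m : ℕ} {u : EuclideanSpace ℝ (Fin (m + 1))} (hu : ‖u‖ = 1) :
    ∃ Ψ : EuclideanSpace ℝ (Fin (m + 1)) ≃ᵐ EuclideanSpace ℝ (Fin m) × ℝ,
      MeasurePreserving Ψ ∧
      (∀ p q, (inner ℝ p q : ℝ) = inner ℝ (Ψ p).1 (Ψ q).1 + (Ψ p).2 * (Ψ q).2) ∧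
      ∀ p, (Ψ p).2 = inner ℝ p u := by
  obtain ⟨b, hb⟩ := Orthonormal.exists_orthonormalBasis_extension_of_card_eq (𝕜 := ℝ)
    (E := EuclideanSpace ℝ (Fin (m + 1))) (ι := Fin (m + 1)) (by simp) (v := fun _ => u)
    (s := {0}) (by
      constructor
      · intro i; simpa using hu
      · intro i j hij
        exact absurd (Subsingleton.elim i j) hij)
  let Ψ₁ : EuclideanSpace ℝ (Fin (m + 1)) ≃ᵐ (Fin (m + 1) → ℝ) :=
    b.measurableEquiv.trans (MeasurableEquiv.toLp 2 (Fin (m + 1) → ℝ)).symm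
  have h₁ : MeasurePreserving Ψ₁ :=
    b.measurePreserving_measurableEquiv.trans (PiLp.volume_preserving_ofLp _)
  let Ψ₂ : (Fin (m + 1) → ℝ) ≃ᵐ ℝ × (Fin m → ℝ) :=
    MeasurableEquiv.piFinSuccAbove (fun _ => ℝ) 0
  have h₂ : MeasurePreserving Ψ₂ := volume_preserving_piFinSuccAbove (fun _ => ℝ) 0
  let Ψ₃ : ℝ × (Fin m → ℝ) ≃ᵐ EuclideanSpace ℝ (Fin m) × ℝ :=
    MeasurableEquiv.prodComm.trans
      ((MeasurableEquiv.toLp 2 (Fin m → ℝ)).prodCongr (MeasurableEquiv.refl ℝ))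
  have h₃ : MeasurePreserving Ψ₃ :=
    Measure.measurePreserving_swap.trans
      ((PiLp.volume_preserving_toLp (Fin m)).prod (MeasurePreserving.id volume))
  refine ⟨(Ψ₁.trans Ψ₂).trans Ψ₃, (h₁.trans h₂).trans h₃, ?_, ?_⟩
  · intro p q
    have e1 : ∀ p i, ((((Ψ₁.trans Ψ₂).trans Ψ₃) p).1 : EuclideanSpace ℝ (Fin m)) i =
      b.repr p i.succ := fun p i => rfl
    have e2 : ∀ p, (((Ψ₁.trans Ψ₂).trans Ψ₃) p).2 = b.repr p 0 := fun p => rfl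
    rw [← b.repr.inner_map_map p q, PiLp.inner_apply, PiLp.inner_apply, Fin.sum_univ_succ, e2, e2]
    simp only [e1]
    simp
    ring
  · intro p
    have e2 : (((Ψ₁.trans Ψ₂).trans Ψ₃) p).2 = b.repr p 0 := rfl
    rw [e2, b.repr_apply_apply, hb 0 rfl, real_inner_comm]

/-- The first moment of `f` over `S` is finite and lies on the line spanned by `w`. -/
def HasAxialMoment {n : ℕ} (f : EuclideanSpace ℝ (Fin n) → ℝ≥0∞) (S : Set (EuclideanSpace ℝ (Fin n)))
    (w : EuclideanSpace ℝ (Fin n)) : Prop :=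
  ∀ ℓ, inner ℝ ℓ w = 0 →
    ∫⁻ p in S, ENNReal.ofReal (inner ℝ ℓ p) * f p = ∫⁻ p in S, ENNReal.ofReal (-inner ℝ ℓ p) * f p ∧
    ∫⁻ p in S, ENNReal.ofReal (inner ℝ ℓ p) * f p ≠ ⊤

/-- While `f` is cut by the hyperplane orthogonal to `u`, its dual partner `g` is cut by the one
orthogonal to `w`. The half-space bounds read `αγ ≤ C/4` and `βδ ≤ C/4`; multiplying them by `β` and
`α` and adding gives `αβ(γ + δ) ≤ (α + β) C/4`. -/
theorem FunctionalSantalo.split {m : ℕ} (hB : FunctionalSantalo m)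
    {f g : EuclideanSpace ℝ (Fin (m + 1)) → ℝ≥0∞} (hf : Measurable f) (hg : Measurable g)
    (H : ∀ p q, f p * g q ≤ ENNReal.ofReal (Real.exp (-inner ℝ p q)))
    {u w : EuclideanSpace ℝ (Fin (m + 1))} (hu : ‖u‖ = 1) (hwu : inner ℝ w u ≠ 0)
    (hP : HasAxialMoment f {p | 0 < inner ℝ p u} w)
    (hN : HasAxialMoment f {p | inner ℝ p u < 0} w) :
    (∫⁻ p in {p | 0 < inner ℝ p u}, f p) * (∫⁻ p in {p | inner ℝ p u < 0}, f p) * ∫⁻ q, g q ≤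
      (∫⁻ p, f p) * ENNReal.ofReal ((2 * Real.pi) ^ (m + 1) / 4) := by
  obtain ⟨Ψ, mp, hin, hlast⟩ := exists_coordinates hu
  have pull : ∀ (φ : EuclideanSpace ℝ (Fin (m + 1)) → ℝ≥0∞) S T, (∀ p, p ∈ S ↔ Ψ p ∈ T) →
      ∫⁻ p in T, φ (Ψ.symm p) = ∫⁻ p in S, φ p := by
    intro φ S T h
    have : S = Ψ ⁻¹' T := by ext p; exact h p
    rw [this, ← mp.setLIntegral_comp_preimage_emb Ψ.measurableEmbedding]
    simp
  have hw2 : (Ψ w).2 ≠ 0 := by rwa [hlast]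
  -- The direction `w` is rescaled to height 1, so that it becomes `(w', 1)` in these coordinates.
  set w' := (Ψ w).2⁻¹ • (Ψ w).1 with hw'
  set v := Ψ.symm (w', 1) with hv
  have hv0 : v ≠ 0 := by
    intro h
    have := hin v v
    rw [h, inner_self_eq_zero.2 rfl, ← h, hv, Ψ.apply_symm_apply] at this
    have h2 := real_inner_self_nonneg (x := w')
    simp only at this
    nlinarith
  have hvq : ∀ q, (Ψ q).2 + inner ℝ w' (Ψ q).1 = inner ℝ q v := by
    intro q
    rw [hin q v, hv, Ψ.apply_symm_apply, real_inner_comm]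
    ring
  -- Linear forms in the sheared coordinate are exactly the forms given by vectors `(ℓ, -⟪ℓ, w'⟫)`,
  -- which are orthogonal to `w`; there the axial moment condition applies.
  have hℓ : ∀ (ℓ : EuclideanSpace ℝ (Fin m)) p, inner ℝ ℓ (p.1 - p.2 • w') =
      inner ℝ (Ψ.symm (ℓ, -inner ℝ ℓ w')) (Ψ.symm p) := by
    intro ℓ p
    rw [hin, Ψ.apply_symm_apply, Ψ.apply_symm_apply, inner_sub_right, inner_smul_right]
    ring
  have hℓw : ∀ ℓ : EuclideanSpace ℝ (Fin m), inner ℝ (Ψ.symm (ℓ, -inner ℝ ℓ w')) w = 0 := by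
    intro ℓ
    rw [hin, Ψ.apply_symm_apply, hw', inner_smul_right]
    field_simp
    ring
  have sP : ∀ p, p ∈ {p | 0 < inner ℝ p u} ↔ Ψ p ∈ {p | 0 < p.2} := by
    intro p; simp [hlast]
  have sN : ∀ p, p ∈ {p | inner ℝ p u < 0} ↔ Ψ p ∈ {p | p.2 < 0} := by
    intro p; simp [hlast]
  have dP : ∀ p, p ∈ {p | 0 < inner ℝ p v} ↔ Ψ p ∈ {p | 0 < p.2 + inner ℝ w' p.1} := by
    intro p; simp [hvq]
  have dN : ∀ p, p ∈ {p | inner ℝ p v < 0} ↔ Ψ p ∈ {p | p.2 + inner ℝ w' p.1 < 0} := by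
    intro p; simp [hvq]
  have H' : ∀ p q, f (Ψ.symm p) * g (Ψ.symm q) ≤
      ENNReal.ofReal (Real.exp (-(inner ℝ p.1 q.1 + p.2 * q.2))) := by
    intro p q
    have := H (Ψ.symm p) (Ψ.symm q)
    rwa [hin, Ψ.apply_symm_apply, Ψ.apply_symm_apply] at this
  have hfm : Measurable fun p => f (Ψ.symm p) := hf.comp Ψ.symm.measurable
  have hgm : Measurable fun p => g (Ψ.symm p) := hg.comp Ψ.symm.measurable
  have h1 := hB.upper_half_le hfm hgm H' w'
    (fun ℓ => by
      simp only [hℓ]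
      rw [pull (fun p => ENNReal.ofReal (inner ℝ (Ψ.symm (ℓ, -inner ℝ ℓ w')) p) * f p) _ _ sP,
        pull (fun p => ENNReal.ofReal (-inner ℝ (Ψ.symm (ℓ, -inner ℝ ℓ w')) p) * f p) _ _ sP]
      exact (hP _ (hℓw ℓ)).1)
    (fun ℓ => by
      simp only [hℓ]
      rw [pull (fun p => ENNReal.ofReal (inner ℝ (Ψ.symm (ℓ, -inner ℝ ℓ w')) p) * f p) _ _ sP]
      exact (hP _ (hℓw ℓ)).2)
  have h2 := hB.lower_half_le hfm hgm H' w'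
    (fun ℓ => by
      simp only [hℓ]
      rw [pull (fun p => ENNReal.ofReal (inner ℝ (Ψ.symm (ℓ, -inner ℝ ℓ w')) p) * f p) _ _ sN,
        pull (fun p => ENNReal.ofReal (-inner ℝ (Ψ.symm (ℓ, -inner ℝ ℓ w')) p) * f p) _ _ sN]
      exact (hN _ (hℓw ℓ)).1)
    (fun ℓ => by
      simp only [hℓ]
      rw [pull (fun p => ENNReal.ofReal (inner ℝ (Ψ.symm (ℓ, -inner ℝ ℓ w')) p) * f p) _ _ sN]
      exact (hN _ (hℓw ℓ)).2)
  rw [pull f _ _ sP, pull g _ _ dP] at h1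
  rw [pull f _ _ sN, pull g _ _ dN] at h2
  have hu0 : u ≠ 0 := by
    rintro rfl
    simp at hu
  rw [lintegral_eq_add_of_hyperplane hv0 0 g, lintegral_eq_add_of_hyperplane hu0 0 f]
  set α := ∫⁻ p in {p | 0 < inner ℝ p u}, f p
  set β := ∫⁻ p in {p | inner ℝ p u < 0}, f p
  set γ := ∫⁻ p in {p | 0 < inner ℝ p v}, g p
  set δ := ∫⁻ p in {p | inner ℝ p v < 0}, g p
  calc α * β * (γ + δ) = β * (α * γ) + α * (β * δ) := by ring
    _ ≤ β * ENNReal.ofReal ((2 * Real.pi) ^ (m + 1) / 4) +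
        α * ENNReal.ofReal ((2 * Real.pi) ^ (m + 1) / 4) := by gcongr
    _ = _ := by ring

/-- Intermediate value theorem: the measure of the half-space depends continuously on `a` because
hyperplanes are null, and it runs from the total mass to 0 because the measure has bounded support.
-/
theorem exists_measure_halfspace_eq {n : ℕ} {ν : Measure (EuclideanSpace ℝ (Fin n))}
    [IsFiniteMeasure ν] {u : EuclideanSpace ℝ (Fin n)} (hν : ∀ a, ν {y | inner ℝ y u = a} = 0)
    {R : ℝ} (hR : ∀ᵐ y ∂ν, ‖y‖ ≤ R) {c : ℝ≥0∞} (hc : c ≤ ν univ) :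
    ∃ a, ν {y | a ≤ inner ℝ y u} = c := by
  have hm : ∀ a : ℝ, MeasurableSet {y | a ≤ inner ℝ y u} := fun a =>
    measurableSet_le measurable_const (by fun_prop)
  have hcont : Continuous fun a : ℝ => ν {y | a ≤ inner ℝ y u} := by
    refine continuous_iff_continuousAt.2 fun a => ?_
    refine tendsto_measure_of_ae_tendsto_indicator_of_isFiniteMeasure (nhds a) (hm a) hm ?_
    have : ∀ᵐ y ∂ν, inner ℝ y u ≠ a := by
      rw [ae_iff]
      exact measure_mono_null (fun y hy => not_not.1 hy) (hν a)
    filter_upwards [this] with y hy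
    rcases lt_or_gt_of_ne hy with h | h
    · filter_upwards [lt_mem_nhds h] with b hb
      exact iff_of_false (not_le.2 hb) (not_le.2 h)
    · filter_upwards [gt_mem_nhds h] with b hb
      exact iff_of_true hb.le h.le
  have hle : ∀ᵐ y ∂ν, |inner ℝ y u| ≤ R * ‖u‖ := by
    filter_upwards [hR] with y hy
    exact (abs_real_inner_le_norm y u).trans (by gcongr)
  refine mem_range_of_exists_le_of_exists_ge hcont ⟨R * ‖u‖ + 1, ?_⟩ ⟨-(R * ‖u‖), ?_⟩
  · have : ν {y | R * ‖u‖ + 1 ≤ inner ℝ y u} = 0 := by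
      refine measure_mono_null ?_ (ae_iff.1 hle)
      intro y hy
      simp only [mem_ofPred_eq, not_le] at hy ⊢
      exact lt_of_lt_of_le (by linarith) (le_abs_self _)
    simp [this]
  · refine hc.trans (le_of_eq ?_)
    refine measure_congr ?_
    symm
    rw [Filter.eventuallyEq_univ]
    filter_upwards [hle] with y hy
    exact (abs_le.1 hy).1

theorem lintegral_ofReal_eq_of_integral_eq_zero {α : Type*} [MeasurableSpace α] {μ : Measure α}
    {h : α → ℝ} (hi : Integrable h μ) (h0 : ∫ x, h x ∂μ = 0) :
    ∫⁻ x, ENNReal.ofReal (h x) ∂μ = ∫⁻ x, ENNReal.ofReal (-h x) ∂μ ∧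
      ∫⁻ x, ENNReal.ofReal (h x) ∂μ ≠ ⊤ := by
  have hp : ∫⁻ x, ENNReal.ofReal (h x) ∂μ ≠ ⊤ :=
    (lt_of_le_of_lt (lintegral_mono fun x => Real.ofReal_le_enorm (h x)) hi.2).ne
  have hn : ∫⁻ x, ENNReal.ofReal (-h x) ∂μ ≠ ⊤ :=
    (lt_of_le_of_lt (lintegral_mono fun x => Real.ofReal_le_enorm (-h x)) hi.neg.2).ne
  refine ⟨?_, hp⟩
  rw [integral_eq_lintegral_pos_part_sub_lintegral_neg_part hi, sub_eq_zero,
    ENNReal.toReal_eq_toReal_iff' hp hn] at h0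
  exact h0

/-- The line through the barycentres of the two parts of a mass distribution cut by a hyperplane. -/
theorem exists_center {n : ℕ} {ν : Measure (EuclideanSpace ℝ (Fin n))} [IsFiniteMeasure ν]
    {R : ℝ} (hR : ∀ᵐ y ∂ν, ‖y‖ ≤ R) {u : EuclideanSpace ℝ (Fin n)} {a : ℝ}
    (hP : ν {y | a < inner ℝ y u} ≠ 0) (hN : ν {y | inner ℝ y u < a} ≠ 0) :
    ∃ z w : EuclideanSpace ℝ (Fin n), inner ℝ z u = a ∧ inner ℝ w u ≠ 0 ∧
      (∀ ℓ, inner ℝ ℓ w = 0 → ∫ y in {y | a < inner ℝ y u}, inner ℝ ℓ (y - z) ∂ν = 0 ∧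
        ∫ y in {y | inner ℝ y u < a}, inner ℝ ℓ (y - z) ∂ν = 0) ∧
      ∀ C : Set (EuclideanSpace ℝ (Fin n)), Convex ℝ C → IsClosed C → (∀ᵐ y ∂ν, y ∈ C) → z ∈ C := by
  have hid : Integrable (fun y => y) ν :=
    Integrable.of_bound aestronglyMeasurable_id R hR
  have hmP : MeasurableSet {y : EuclideanSpace ℝ (Fin n) | a < inner ℝ y u} :=
    measurableSet_lt measurable_const (by fun_prop)
  have hmN : MeasurableSet {y : EuclideanSpace ℝ (Fin n) | inner ℝ y u < a} :=
    measurableSet_lt (by fun_prop) measurable_const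
  set P := {y : EuclideanSpace ℝ (Fin n) | a < inner ℝ y u} with hPdef
  set N := {y : EuclideanSpace ℝ (Fin n) | inner ℝ y u < a} with hNdef
  have bary : ∀ (S : Set (EuclideanSpace ℝ (Fin n))), ν S ≠ 0 → ∀ ℓ c : EuclideanSpace ℝ (Fin n),
      ∫ y in S, inner ℝ ℓ (y - c) ∂ν = ν.real S * inner ℝ ℓ ((⨍ y in S, y ∂ν) - c) := by
    intro S hS ℓ c
    have hr : ν.real S ≠ 0 := by simpa [Measure.real, ENNReal.toReal_eq_zero_iff] using hS
    have h1 : ∫ y in S, inner ℝ ℓ (y - c) ∂ν = inner ℝ ℓ (∫ y in S, (y - c) ∂ν) :=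
      integral_inner (hid.integrableOn.sub (integrable_const c)) ℓ
    have h2 : (∫ y in S, (y - c) ∂ν) = ν.real S • ((⨍ y in S, y ∂ν) - c) := by
      rw [integral_sub hid.integrableOn (integrable_const c), setAverage_eq, smul_sub, smul_smul,
        mul_inv_cancel₀ hr, one_smul, setIntegral_const]
    rw [h1, h2, inner_smul_right]
  have pos : ∀ (S : Set (EuclideanSpace ℝ (Fin n))) (v : EuclideanSpace ℝ (Fin n)) (b : ℝ),
      MeasurableSet S → ν S ≠ 0 → (∀ y ∈ S, 0 < inner ℝ v y - b) →
      0 < inner ℝ v (⨍ y in S, y ∂ν) - b := by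
    intro S v b hSm hS hpos
    have h3 : 0 < ∫ y in S, (inner ℝ v y - b) ∂ν := by
      rw [setIntegral_pos_iff_support_of_nonneg_ae]
      · refine lt_of_lt_of_le (pos_iff_ne_zero.2 hS) (measure_mono ?_)
        intro y hy
        exact ⟨(hpos y hy).ne', hy⟩
      · filter_upwards [ae_restrict_mem hSm] with y hy using (hpos y hy).le
      · exact (hid.integrableOn.const_inner v).sub (integrable_const b)
    have hr : 0 < ν.real S := by
      rw [Measure.real, ENNReal.toReal_pos_iff]
      exact ⟨pos_iff_ne_zero.2 hS, measure_lt_top _ _⟩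
    rw [integral_sub (hid.integrableOn.const_inner v) (integrable_const b), setIntegral_const] at h3
    have h4 := bary S hS v 0
    simp only [sub_zero] at h4
    rw [h4, smul_eq_mul, ← mul_sub] at h3
    exact (pos_iff_pos_of_mul_pos h3).1 hr
  set p := ⨍ y in P, y ∂ν with hp
  set q := ⨍ y in N, y ∂ν with hq
  have hpu : a < inner ℝ p u := by
    have := pos P u a hmP hP (fun y hy => by rw [real_inner_comm]; exact sub_pos.2 hy)
    rw [real_inner_comm] at this
    linarith
  have hqu : inner ℝ q u < a := by
    have := pos N (-u) (-a) hmN hN (fun y hy => by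
      rw [inner_neg_left, real_inner_comm]; simp only [hNdef, mem_ofPred_eq] at hy; linarith)
    rw [inner_neg_left, real_inner_comm] at this
    linarith
  have hd : 0 < inner ℝ p u - inner ℝ q u := by linarith
  -- The parameter at which the segment from `q` to `p` crosses the hyperplane. Then `p - z` and `q
  -- - z` are multiples of `p - q`, so forms vanishing on `p - q` have zero moment about `z` on each
  -- side.
  set τ := (a - inner ℝ q u) / (inner ℝ p u - inner ℝ q u) with hτ
  have hτ0 : 0 ≤ τ := div_nonneg (by linarith) hd.le
  have hτ1 : τ ≤ 1 := (div_le_one hd).2 (by linarith)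
  refine ⟨q + τ • (p - q), p - q, ?_, ?_, ?_, ?_⟩
  · rw [inner_add_left, inner_smul_left, inner_sub_left, hτ]
    simp only [RCLike.conj_to_real]
    field_simp
    ring
  · rw [inner_sub_left]; exact hd.ne'
  · intro ℓ hℓ
    constructor
    · rw [bary P hP, ← hp]
      have : p - (q + τ • (p - q)) = (1 - τ) • (p - q) := by module
      rw [this, inner_smul_right, hℓ]
      simp
    · rw [bary N hN, ← hq]
      have : q - (q + τ • (p - q)) = (-τ) • (p - q) := by module
      rw [this, inner_smul_right, hℓ]
      simp
  · intro C hC hCc hae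
    have hpC : p ∈ C := hC.set_average_mem hCc hP (by finiteness) (ae_restrict_of_ae hae)
      hid.integrableOn
    have hqC : q ∈ C := hC.set_average_mem hCc hN (by finiteness) (ae_restrict_of_ae hae)
      hid.integrableOn
    have := hC hqC hpC (sub_nonneg.2 hτ1) hτ0 (by ring)
    convert! this using 1
    module

theorem setLIntegral_comp_add {n : ℕ} (z : EuclideanSpace ℝ (Fin n))
    {S : Set (EuclideanSpace ℝ (Fin n))} (φ : EuclideanSpace ℝ (Fin n) → ℝ≥0∞) :
    ∫⁻ p in (fun p => p + z) ⁻¹' S, φ (p + z) = ∫⁻ p in S, φ p :=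
  (measurePreserving_add_right volume z).setLIntegral_comp_preimage_emb
    (MeasurableEquiv.addRight z).measurableEmbedding φ S

/-- Turns the vanishing signed moments about `z` supplied by `exists_center` into the `ℝ≥0∞`-valued
condition for the translated density. -/
theorem hasAxialMoment_translate {n : ℕ} {g : EuclideanSpace ℝ (Fin n) → ℝ≥0∞} (hg : Measurable g)
    [IsFiniteMeasure (volume.withDensity g)] {R : ℝ}
    (hR : ∀ᵐ y ∂(volume.withDensity g), ‖y‖ ≤ R) {S T : Set (EuclideanSpace ℝ (Fin n))}
    (hS : MeasurableSet S) {z w : EuclideanSpace ℝ (Fin n)}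
    (h : ∀ ℓ, inner ℝ ℓ w = 0 → ∫ y in S, inner ℝ ℓ (y - z) ∂(volume.withDensity g) = 0)
    (hT : T = (fun p => p + z) ⁻¹' S) :
    HasAxialMoment (fun p => g (p + z)) T w := by
  have hid : Integrable (fun y => y) (volume.withDensity g) :=
    Integrable.of_bound aestronglyMeasurable_id R hR
  subst hT
  intro ℓ hℓ
  have key := lintegral_ofReal_eq_of_integral_eq_zero
    (((hid.sub (integrable_const z)).const_inner ℓ).integrableOn (s := S)) (h ℓ hℓ)
  have conv : ∀ φ : EuclideanSpace ℝ (Fin n) → ℝ≥0∞, Measurable φ →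
      ∫⁻ y in S, φ (y - z) ∂(volume.withDensity g) =
        ∫⁻ p in (fun p => p + z) ⁻¹' S, φ p * g (p + z) := by
    intro φ hφ
    rw [restrict_withDensity hS, lintegral_withDensity_eq_lintegral_mul _ hg (by fun_prop),
      ← setLIntegral_comp_add z]
    refine lintegral_congr fun p => ?_
    simp [mul_comm]
  have e1 := conv (fun p => ENNReal.ofReal (inner ℝ ℓ p)) (by fun_prop)
  have e2 := conv (fun p => ENNReal.ofReal (-inner ℝ ℓ p)) (by fun_prop)
  rw [← e1, ← e2]
  exact key

theorem functionalSantalo_zero : FunctionalSantalo 0 := by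
  intro f g _ _ H
  have hv : (volume : Measure (EuclideanSpace ℝ (Fin 0))) univ = 1 := by
    rw [volume_euclideanSpace_eq_dirac]
    simp
  rw [lintegral_unique, lintegral_unique, hv, mul_one, mul_one]
  refine (H _ _).trans (ENNReal.ofReal_le_ofReal ?_)
  rw [Subsingleton.elim (@default (EuclideanSpace ℝ (Fin 0)) Unique.instInhabited) 0]
  simp

/-- A hyperplane halving the mass `I` of `g` is chosen, and `g` is recentred at the point `z` of
`exists_center`, which costs a factor `exp ⟪z, ·⟫` on `f`. With `J` the integral of the tilted `f`,
`FunctionalSantalo.split` gives `(I/2)² J ≤ I (2π)^(m+1)/4`. Centring of `f` ensures that `J` is at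
least the integral of `f`. -/
theorem FunctionalSantalo.succ_of_bounded {m : ℕ} (hB : FunctionalSantalo m)
    {f g : EuclideanSpace ℝ (Fin (m + 1)) → ℝ≥0∞} (hf : IsCentered f) (hg : Measurable g)
    (H : ∀ x y, f x * g y ≤ ENNReal.ofReal (Real.exp (-inner ℝ x y)))
    (hgi : ∫⁻ y, g y ≠ ⊤) {R : ℝ} (hR : ∀ y, R < ‖y‖ → g y = 0) :
    (∫⁻ x, f x) * ∫⁻ y, g y ≤ ENNReal.ofReal ((2 * Real.pi) ^ (m + 1)) := by
  rcases eq_or_ne (∫⁻ y, g y) 0 with h0 | h0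
  · simp [h0]
  have hfin : IsFiniteMeasure (volume.withDensity g) := isFiniteMeasure_withDensity hgi
  have hRν : ∀ᵐ y ∂(volume.withDensity g), ‖y‖ ≤ R := by
    rw [ae_withDensity_iff hg]
    refine Filter.Eventually.of_forall fun y hy => ?_
    by_contra h
    exact hy (hR y (not_le.1 h))
  let u : EuclideanSpace ℝ (Fin (m + 1)) := EuclideanSpace.single 0 1
  have hu : ‖u‖ = 1 := by simp [u]
  have hu0 : u ≠ 0 := by
    intro h
    simp [h] at hu
  have hhyp : ∀ a, volume.withDensity g {y | inner ℝ y u = a} = 0 := fun a =>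
    withDensity_absolutelyContinuous _ _ (volume_inner_eq hu0 a)
  set I := ∫⁻ y, g y with hI
  have huniv : volume.withDensity g univ = I := by
    rw [withDensity_apply _ MeasurableSet.univ, setLIntegral_univ]
  obtain ⟨a, ha⟩ := exists_measure_halfspace_eq hhyp hRν (c := I / 2)
    (by rw [huniv]; exact ENNReal.half_le_self)
  have hmP : MeasurableSet {y : EuclideanSpace ℝ (Fin (m + 1)) | a < inner ℝ y u} :=
    measurableSet_lt measurable_const (by fun_prop)
  have hmN : MeasurableSet {y : EuclideanSpace ℝ (Fin (m + 1)) | inner ℝ y u < a} :=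
    measurableSet_lt (by fun_prop) measurable_const
  have hP : ∫⁻ y in {y | a < inner ℝ y u}, g y = I / 2 := by
    rw [← withDensity_apply _ hmP, ← ha]
    refine le_antisymm (measure_mono fun y (hy : a < _) => hy.le) ?_
    have : {y : EuclideanSpace ℝ (Fin (m + 1)) | a ≤ inner ℝ y u} ⊆
        {y | a < inner ℝ y u} ∪ {y | inner ℝ y u = a} := fun y hy => by
      rcases (show a ≤ inner ℝ y u from hy).lt_or_eq with h | h
      · exact Or.inl h
      · exact Or.inr h.symm
    exact (measure_mono this).trans ((measure_union_le _ _).trans (by rw [hhyp a, add_zero]))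
  have hN : ∫⁻ y in {y | inner ℝ y u < a}, g y = I / 2 := by
    have := lintegral_eq_add_of_hyperplane hu0 a g
    rw [hP, ← hI] at this
    have h2 : I / 2 + ∫⁻ y in {y | inner ℝ y u < a}, g y = I / 2 + I / 2 := by
      rw [← this, ENNReal.add_halves]
    exact (ENNReal.add_right_inj (ENNReal.div_ne_top hgi (by simp))).1 h2
  have hI2 : I / 2 ≠ 0 := (ENNReal.half_pos h0).ne'
  obtain ⟨z, w, hzu, hwu, hax, -⟩ := exists_center (ν := volume.withDensity g) (u := u) (a := a) hRν
    (by rw [withDensity_apply _ hmP, hP]; exact hI2)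
    (by rw [withDensity_apply _ hmN, hN]; exact hI2)
  have tP : {p : EuclideanSpace ℝ (Fin (m + 1)) | 0 < inner ℝ p u} =
      (fun p => p + z) ⁻¹' {y | a < inner ℝ y u} := by
    ext p
    simp [inner_add_left, hzu]
  have tN : {p : EuclideanSpace ℝ (Fin (m + 1)) | inner ℝ p u < 0} =
      (fun p => p + z) ⁻¹' {y | inner ℝ y u < a} := by
    ext p
    simp [inner_add_left, hzu]
  have hm := hf.measurable
  have hsplit := hB.split (f := fun p => g (p + z))
    (g := fun q => f q * ENNReal.ofReal (Real.exp (inner ℝ z q))) (by fun_prop) (by fun_prop)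
    (fun p q => by
      calc g (p + z) * (f q * ENNReal.ofReal (Real.exp (inner ℝ z q)))
          = (f q * g (p + z)) * ENNReal.ofReal (Real.exp (inner ℝ z q)) := by ring
        _ ≤ ENNReal.ofReal (Real.exp (-inner ℝ q (p + z))) *
            ENNReal.ofReal (Real.exp (inner ℝ z q)) := by gcongr; exact H _ _
        _ = _ := by
          rw [← ENNReal.ofReal_mul (Real.exp_pos _).le, ← Real.exp_add, inner_add_right,
            real_inner_comm q p, real_inner_comm q z]
          congr 2
          ring) hu hwu
    (hasAxialMoment_translate hg hRν hmP (fun ℓ hℓ => (hax ℓ hℓ).1) tP)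
    (hasAxialMoment_translate hg hRν hmN (fun ℓ hℓ => (hax ℓ hℓ).2) tN)
  rw [tP, tN, setLIntegral_comp_add z, setLIntegral_comp_add z, hP, hN,
    lintegral_add_right_eq_self g z, ← hI] at hsplit
  -- This is `1 + s ≤ exp s` integrated against `f`, the linear term having zero integral. Its
  -- positive and negative parts are kept on opposite sides to avoid subtraction in `ℝ≥0∞`.
  have hmono : ∫⁻ x, f x ≤ ∫⁻ q, f q * ENNReal.ofReal (Real.exp (inner ℝ z q)) := by
    refine (ENNReal.add_le_add_iff_right (hf.moment_ne_top z)).1 ?_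
    nth_rewrite 2 [hf.moment_eq z]
    rw [← lintegral_add_left hm, ← lintegral_add_left (by fun_prop)]
    refine lintegral_mono fun x => ?_
    have : 1 + ENNReal.ofReal (inner ℝ z x) ≤
        ENNReal.ofReal (Real.exp (inner ℝ z x)) + ENNReal.ofReal (-inner ℝ z x) := by
      rcases le_total 0 (inner ℝ z x : ℝ) with h | h
      · rw [ENNReal.ofReal_of_nonpos (neg_nonpos.2 h), add_zero, ← ENNReal.ofReal_one,
          ← ENNReal.ofReal_add zero_le_one h]
        apply ENNReal.ofReal_le_ofReal
        linarith [Real.add_one_le_exp (inner ℝ z x)]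
      · rw [ENNReal.ofReal_of_nonpos h, add_zero, ← ENNReal.ofReal_one,
          ← ENNReal.ofReal_add (Real.exp_pos _).le (neg_nonneg.2 h)]
        apply ENNReal.ofReal_le_ofReal
        linarith [Real.add_one_le_exp (inner ℝ z x)]
    calc f x + ENNReal.ofReal (inner ℝ z x) * f x = (1 + ENNReal.ofReal (inner ℝ z x)) * f x := by
          ring
      _ ≤ (ENNReal.ofReal (Real.exp (inner ℝ z x)) + ENNReal.ofReal (-inner ℝ z x)) * f x := by
          gcongr
      _ = _ := by ring
  set J := ∫⁻ q, f q * ENNReal.ofReal (Real.exp (inner ℝ z q))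
  set c := (2 * Real.pi) ^ (m + 1)
  have hc : 0 ≤ c := by positivity
  have hc4 : ENNReal.ofReal (c / 4) = ENNReal.ofReal c / 4 := by
    rw [ENNReal.ofReal_div_of_pos (by norm_num)]; simp
  refine (mul_le_mul_left hmono I).trans ?_
  rw [hc4, ENNReal.div_eq_inv_mul, ENNReal.div_eq_inv_mul] at hsplit
  have e4 : (2 : ℝ≥0∞)⁻¹ * I * (2⁻¹ * I) * J = (4⁻¹ * I) * (J * I) := by
    have : (4 : ℝ≥0∞)⁻¹ = 2⁻¹ * 2⁻¹ := by
      rw [← ENNReal.mul_inv (by simp) (by simp)]; norm_num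
    rw [this]; ring
  have e5 : I * (4⁻¹ * ENNReal.ofReal c) = (4⁻¹ * I) * ENNReal.ofReal c := by ring
  rw [e4, e5] at hsplit
  refine (ENNReal.mul_le_mul_iff_right ?_ ?_).1 hsplit
  · exact mul_ne_zero (by simp) h0
  · exact ENNReal.mul_ne_top (by simp) hgi

/-- Monotone exhaustion of `g` by cutting off its height and its support at `k`. Only `g` is
truncated, so the centring of `f` is not disturbed. -/
theorem FunctionalSantalo.succ {m : ℕ} (hB : FunctionalSantalo m) : FunctionalSantalo (m + 1) := by
  intro f g hf hg H
  let G : ℕ → EuclideanSpace ℝ (Fin (m + 1)) → ℝ≥0∞ :=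
    fun k => (Metric.closedBall 0 k).indicator fun y => min (g y) k
  have hGm : ∀ k, Measurable (G k) := fun k =>
    (hg.min measurable_const).indicator Metric.isClosed_closedBall.measurableSet
  have hGle : ∀ k y, G k y ≤ g y := fun k y =>
    (indicator_le_self _ _ y).trans (min_le_left _ _)
  have hmono : Monotone G := by
    intro k l hkl y
    have hkl' : (k : ℝ) ≤ l := by exact_mod_cast hkl
    refine (indicator_le_indicator_of_subset (Metric.closedBall_subset_closedBall hkl')
      (fun _ => bot_le) y).trans (indicator_le_indicator ?_)
    exact min_le_min_left _ (by exact_mod_cast hkl)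
  have hsup : ∀ y, g y = ⨆ k, G k y := by
    intro y
    refine le_antisymm ?_ (iSup_le fun k => hGle k y)
    refine le_of_forall_lt fun c hc => ?_
    obtain ⟨k, hk⟩ := ENNReal.exists_nat_gt hc.ne_top
    obtain ⟨l, hl⟩ := exists_nat_ge ‖y‖
    refine lt_of_lt_of_le ?_ (le_iSup (fun k => G k y) (max k l))
    have hy : y ∈ Metric.closedBall (0 : EuclideanSpace ℝ (Fin (m + 1))) ((max k l : ℕ) : ℝ) := by
      rw [mem_closedBall_zero_iff]
      exact hl.trans (by exact_mod_cast le_max_right k l)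
    simp only [G, indicator_of_mem hy]
    exact lt_min hc (hk.trans_le (by exact_mod_cast le_max_left k l))
  have : ∫⁻ y, g y = ⨆ k, ∫⁻ y, G k y := by
    rw [← lintegral_iSup hGm hmono]
    exact lintegral_congr hsup
  rw [this, ENNReal.mul_iSup]
  refine iSup_le fun k => ?_
  refine hB.succ_of_bounded hf (hGm k) (fun x y => (mul_le_mul_right (hGle k y) _).trans (H x y))
    ?_ (R := k) ?_
  · refine ne_of_lt ?_
    calc ∫⁻ y, G k y ≤ ∫⁻ y, (Metric.closedBall 0 (k : ℝ)).indicator (fun _ => (k : ℝ≥0∞)) y :=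
          lintegral_mono fun y => indicator_le_indicator (min_le_right _ _)
      _ = k * volume (Metric.closedBall (0 : EuclideanSpace ℝ (Fin (m + 1))) (k : ℝ)) := by
          rw [lintegral_indicator_const Metric.isClosed_closedBall.measurableSet]
      _ < ⊤ := ENNReal.mul_lt_top (by simp) measure_closedBall_lt_top
  · intro y hy
    refine indicator_of_notMem ?_ _
    rw [mem_closedBall_zero_iff]
    exact not_le.2 hy

/-- The functional Blaschke–Santaló inequality. -/
theorem functionalSantalo (n : ℕ) : FunctionalSantalo n := by
  induction n with
  | zero => exact functionalSantalo_zero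
  | succ m ih => exact ih.succ

/-! ### From sets to functions: superpositions of dilates -/

/-- The superposition, with weight `κ`, of the indicators of the dilates of `A`. -/
noncomputable def layer {n : ℕ} (κ : ℝ → ℝ≥0∞) (A : Set (EuclideanSpace ℝ (Fin n)))
    (x : EuclideanSpace ℝ (Fin n)) : ℝ≥0∞ :=
  ∫⁻ r in Ioi (0 : ℝ), A.indicator 1 (r⁻¹ • x) * κ r

theorem measurable_layer_integrand {n : ℕ} {κ : ℝ → ℝ≥0∞} (hκ : Measurable κ)
    {A : Set (EuclideanSpace ℝ (Fin n))} (hA : MeasurableSet A) :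
    Measurable fun p : EuclideanSpace ℝ (Fin n) × ℝ => A.indicator 1 (p.2⁻¹ • p.1) * κ p.2 := by
  have h1 : Measurable (A.indicator (1 : EuclideanSpace ℝ (Fin n) → ℝ≥0∞)) :=
    measurable_one.indicator hA
  exact (h1.comp (by fun_prop)).mul (by fun_prop)

theorem measurable_layer {n : ℕ} {κ : ℝ → ℝ≥0∞} (hκ : Measurable κ)
    {A : Set (EuclideanSpace ℝ (Fin n))} (hA : MeasurableSet A) : Measurable (layer κ A) :=
  Measurable.lintegral_prod_right' (measurable_layer_integrand hκ hA)

theorem lintegral_comp_inv_smul {n : ℕ} {F : EuclideanSpace ℝ (Fin n) → ℝ≥0∞} (hF : Measurable F)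
    {r : ℝ} (hr : 0 < r) : ∫⁻ x, F (r⁻¹ • x) = ENNReal.ofReal (r ^ n) * ∫⁻ x, F x := by
  rw [← lintegral_map hF (by fun_prop), Measure.map_addHaar_smul _ (inv_ne_zero hr.ne'),
    lintegral_smul_measure]
  simp [abs_of_pos hr]

/-- Tonelli and the substitution `x = r y`: the volume contributes `r^n` and the homogeneity of `φ`
contributes `r^k`. -/
theorem lintegral_mul_layer {n : ℕ} {κ : ℝ → ℝ≥0∞} (hκ : Measurable κ)
    {A : Set (EuclideanSpace ℝ (Fin n))} (hA : MeasurableSet A)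
    {φ : EuclideanSpace ℝ (Fin n) → ℝ≥0∞} (hφ : Measurable φ) (k : ℕ)
    (hk : ∀ r : ℝ, 0 < r → ∀ x, φ (r • x) = ENNReal.ofReal (r ^ k) * φ x) :
    ∫⁻ x, φ x * layer κ A x =
      (∫⁻ r in Ioi (0 : ℝ), ENNReal.ofReal (r ^ (n + k)) * κ r) * ∫⁻ x in A, φ x := by
  have hm := measurable_layer_integrand hκ hA
  have hm1 : ∀ x, Measurable fun r : ℝ => A.indicator 1 (r⁻¹ • x) * κ r := fun x =>
    hm.comp (measurable_const.prodMk measurable_id)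
  have hi : Measurable (A.indicator (1 : EuclideanSpace ℝ (Fin n) → ℝ≥0∞)) :=
    measurable_one.indicator hA
  calc ∫⁻ x, φ x * layer κ A x
      = ∫⁻ x, ∫⁻ r in Ioi (0 : ℝ), φ x * (A.indicator 1 (r⁻¹ • x) * κ r) := by
        refine lintegral_congr fun x => ?_
        rw [layer, lintegral_const_mul _ (hm1 x)]
    _ = ∫⁻ r in Ioi (0 : ℝ), ∫⁻ x, φ x * (A.indicator 1 (r⁻¹ • x) * κ r) := by
        rw [lintegral_lintegral_swap]
        exact ((hφ.comp measurable_fst).mul hm).aemeasurable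
    _ = ∫⁻ r in Ioi (0 : ℝ), (ENNReal.ofReal (r ^ (n + k)) * κ r) * ∫⁻ x in A, φ x := by
        refine setLIntegral_congr_fun measurableSet_Ioi fun r hr => ?_
        have hr : 0 < r := hr
        have e : ∀ x, φ x * (A.indicator 1 (r⁻¹ • x) * κ r) =
            (fun y => (ENNReal.ofReal (r ^ k) * κ r) * A.indicator φ y) (r⁻¹ • x) := by
          intro x
          have : φ x = ENNReal.ofReal (r ^ k) * φ (r⁻¹ • x) := by
            rw [← hk r hr, smul_inv_smul₀ hr.ne']
          rw [this]
          by_cases hx : r⁻¹ • x ∈ A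
          · simp [hx]; ring
          · simp [hx]
        simp only [e]
        rw [lintegral_comp_inv_smul ((hφ.indicator hA).const_mul _) hr,
          lintegral_const_mul _ (hφ.indicator hA), lintegral_indicator hA, pow_add,
          ENNReal.ofReal_mul (by positivity)]
        ring
    _ = _ := by
        rw [lintegral_mul_const _ (by fun_prop)]

/-- The radial weight whose superposition of dilated balls is a Gaussian. -/
noncomputable def gaussWeight (r : ℝ) : ℝ≥0∞ := ENNReal.ofReal (r * Real.exp (-(1 / 2) * r ^ 2))

theorem measurable_gaussWeight : Measurable gaussWeight := by
  unfold gaussWeight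
  fun_prop

theorem lintegral_gaussWeight_Ioi {a : ℝ} (ha : 0 ≤ a) :
    ∫⁻ r in Ioi a, gaussWeight r = ENNReal.ofReal (Real.exp (-(1 / 2) * a ^ 2)) := by
  have hd : ∀ x ∈ Ici a, HasDerivAt (fun r : ℝ => -Real.exp (-(1 / 2) * r ^ 2))
      (x * Real.exp (-(1 / 2) * x ^ 2)) x := by
    intro x _
    have h1 : HasDerivAt (fun r : ℝ => -(1 / 2) * r ^ 2) (-x) x := by
      have := (hasDerivAt_pow 2 x).const_mul (-(1 / 2) : ℝ)
      convert! this using 1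
      simp
    convert! h1.exp.neg using 1
    ring
  have ht : Filter.Tendsto (fun r : ℝ => -Real.exp (-(1 / 2) * r ^ 2)) Filter.atTop (nhds 0) := by
    rw [← neg_zero]
    refine (Real.tendsto_exp_atBot.comp ?_).neg
    refine Filter.Tendsto.const_mul_atTop_of_neg (by norm_num) ?_
    exact Filter.tendsto_pow_atTop two_ne_zero
  have h0 : ∀ x ∈ Ioi a, 0 ≤ x * Real.exp (-(1 / 2) * x ^ 2) := fun x hx =>
    mul_nonneg (ha.trans (le_of_lt hx)) (Real.exp_pos _).le
  unfold gaussWeight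
  rw [← ofReal_integral_eq_lintegral_ofReal (integrableOn_Ioi_deriv_of_nonneg' hd h0 ht),
    integral_Ioi_of_hasDerivAt_of_nonneg' hd h0 ht]
  · simp
  · filter_upwards [ae_restrict_mem measurableSet_Ioi] with x hx using h0 x hx

theorem layer_le_of_forall_le {n : ℕ} {A : Set (EuclideanSpace ℝ (Fin n))}
    {x : EuclideanSpace ℝ (Fin n)} {a : ℝ} (ha : 0 ≤ a)
    (h : ∀ r : ℝ, 0 < r → r⁻¹ • x ∈ A → a ≤ r) :
    layer gaussWeight A x ≤ ENNReal.ofReal (Real.exp (-(1 / 2) * a ^ 2)) := by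
  rw [← lintegral_gaussWeight_Ioi ha, ← setLIntegral_congr Ioi_ae_eq_Ici.symm, layer,
    ← lintegral_indicator measurableSet_Ioi, ← lintegral_indicator measurableSet_Ici]
  refine lintegral_mono fun r => ?_
  by_cases hr : r ∈ Ioi (0 : ℝ)
  · rw [indicator_of_mem hr]
    by_cases hx : r⁻¹ • x ∈ A
    · rw [indicator_of_mem (show r ∈ Ici a from h r hr hx)]
      simp [hx]
    · simp [hx]
  · simp [indicator_of_notMem hr]

/-- Let `a`, `b` be the infima of the dilation factors `r` with `x ∈ rA` and with `y ∈ rB`. Polarity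
gives `⟪x, y⟫ ≤ ab`, the layers are at most `exp(-a²/2)` and `exp(-b²/2)`, and `ab ≤ (a² + b²)/2`.
-/
theorem layer_gaussWeight_mul_le {n : ℕ} {A B : Set (EuclideanSpace ℝ (Fin n))}
    (hAB : ∀ x ∈ A, ∀ y ∈ B, inner ℝ x y ≤ 1) (x y : EuclideanSpace ℝ (Fin n)) :
    layer gaussWeight A x * layer gaussWeight B y ≤
      ENNReal.ofReal (Real.exp (-inner ℝ x y)) := by
  set I := {r : ℝ | 0 < r ∧ r⁻¹ • x ∈ A} with hI
  set J := {r : ℝ | 0 < r ∧ r⁻¹ • y ∈ B} with hJ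
  have empty : ∀ (C : Set (EuclideanSpace ℝ (Fin n))) (v : EuclideanSpace ℝ (Fin n)),
      {r : ℝ | 0 < r ∧ r⁻¹ • v ∈ C} = ∅ → layer gaussWeight C v = 0 := by
    intro C v h
    rw [layer, setLIntegral_congr_fun (g := fun _ => 0) measurableSet_Ioi, lintegral_zero]
    intro r hr
    have : r⁻¹ • v ∉ C := fun hv => (h ▸ (⟨hr, hv⟩ : r ∈ {r : ℝ | 0 < r ∧ r⁻¹ • v ∈ C}) : r ∈ (∅ : Set ℝ))
    simp [this]
  rcases I.eq_empty_or_nonempty with hI0 | hI0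
  · rw [empty A x hI0]; simp
  rcases J.eq_empty_or_nonempty with hJ0 | hJ0
  · rw [empty B y hJ0]; simp
  have bI : BddBelow I := ⟨0, fun r hr => hr.1.le⟩
  have bJ : BddBelow J := ⟨0, fun r hr => hr.1.le⟩
  have a0 : 0 ≤ sInf I := Real.sInf_nonneg fun r hr => hr.1.le
  have b0 : 0 ≤ sInf J := Real.sInf_nonneg fun r hr => hr.1.le
  have h1 : ∀ r ∈ I, ∀ s ∈ J, inner ℝ x y ≤ r * s := by
    intro r hr s hs
    have := hAB _ hr.2 _ hs.2
    rw [inner_smul_left, inner_smul_right] at this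
    simp only [RCLike.conj_to_real] at this
    rw [← mul_assoc, ← mul_inv, inv_mul_le_iff₀ (mul_pos hr.1 hs.1), mul_one] at this
    exact this
  have h2 : ∀ r ∈ I, inner ℝ x y ≤ r * sInf J := by
    intro r hr
    have : inner ℝ x y / r ≤ sInf J := le_csInf hJ0 fun s hs => by
      rw [div_le_iff₀ hr.1, mul_comm]; exact h1 r hr s hs
    rwa [div_le_iff₀ hr.1, mul_comm] at this
  have h3 : inner ℝ x y ≤ sInf I * sInf J := by
    rcases b0.eq_or_lt with h | h
    · obtain ⟨r, hr⟩ := hI0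
      have := h2 r hr
      rw [← h] at this ⊢
      simpa using this
    · have : inner ℝ x y / sInf J ≤ sInf I := le_csInf hI0 fun r hr => by
        rw [div_le_iff₀ h]; exact h2 r hr
      rwa [div_le_iff₀ h] at this
  calc _ ≤ ENNReal.ofReal (Real.exp (-(1 / 2) * sInf I ^ 2)) *
        ENNReal.ofReal (Real.exp (-(1 / 2) * sInf J ^ 2)) :=
        mul_le_mul' (layer_le_of_forall_le a0 fun r hr hx => csInf_le bI ⟨hr, hx⟩)
          (layer_le_of_forall_le b0 fun r hr hx => csInf_le bJ ⟨hr, hx⟩)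
    _ ≤ _ := by
      rw [← ENNReal.ofReal_mul (Real.exp_pos _).le, ← Real.exp_add]
      apply ENNReal.ofReal_le_ofReal
      apply Real.exp_le_exp.2
      nlinarith [sq_nonneg (sInf I - sInf J)]

/-- The radial moments of the Gaussian weight. -/
noncomputable def gaussMoment (n : ℕ) : ℝ≥0∞ :=
  ∫⁻ r in Ioi (0 : ℝ), ENNReal.ofReal (r ^ n) * gaussWeight r

theorem lintegral_layer {n : ℕ} {A : Set (EuclideanSpace ℝ (Fin n))} (hA : MeasurableSet A) :
    ∫⁻ x, layer gaussWeight A x = gaussMoment n * volume A := by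
  have := lintegral_mul_layer measurable_gaussWeight hA (φ := fun _ => 1) measurable_const 0
    (by simp)
  simpa [gaussMoment] using this

/-- The layer of the unit ball is the Gaussian `exp(-‖x‖²/2)`, whose integral is known; this also
shows that the moment is positive and finite. -/
theorem gaussMoment_mul_volume_ball (n : ℕ) :
    gaussMoment n * volume (Metric.ball (0 : EuclideanSpace ℝ (Fin n)) 1) =
      ENNReal.ofReal ((2 * Real.pi) ^ (n / 2 : ℝ)) := by
  rw [← lintegral_layer Metric.isOpen_ball.measurableSet]
  have : ∀ x : EuclideanSpace ℝ (Fin n), layer gaussWeight (Metric.ball 0 1) x =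
      ENNReal.ofReal (Real.exp (-(1 / 2) * ‖x‖ ^ 2)) := by
    intro x
    rw [← lintegral_gaussWeight_Ioi (norm_nonneg x), layer,
      ← lintegral_indicator measurableSet_Ioi, ← lintegral_indicator measurableSet_Ioi]
    refine lintegral_congr fun r => ?_
    by_cases hr : r ∈ Ioi (0 : ℝ)
    · have hr' : 0 < r := hr
      have : r⁻¹ • x ∈ Metric.ball (0 : EuclideanSpace ℝ (Fin n)) 1 ↔ r ∈ Ioi ‖x‖ := by
        rw [mem_ball_zero_iff, norm_smul, norm_inv, Real.norm_of_nonneg hr'.le,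
          inv_mul_lt_iff₀ hr', mul_one, mem_Ioi]
      rw [indicator_of_mem hr]
      by_cases hx : r ∈ Ioi ‖x‖
      · rw [indicator_of_mem hx, indicator_of_mem (this.2 hx)]; simp
      · rw [indicator_of_notMem hx, indicator_of_notMem (this.not.2 hx)]; simp
    · have : r ∉ Ioi ‖x‖ := fun h => hr (lt_of_le_of_lt (norm_nonneg x) h)
      rw [indicator_of_notMem hr, indicator_of_notMem this]
  simp only [this]
  have hI : ∫ x : EuclideanSpace ℝ (Fin n), Real.exp (-(1 / 2) * ‖x‖ ^ 2) =
      (2 * Real.pi) ^ (n / 2 : ℝ) := by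
    rw [GaussianFourier.integral_rexp_neg_mul_sq_norm (by norm_num)]
    congr 1
    · ring
    · simp
  rw [← hI, ofReal_integral_eq_lintegral_ofReal]
  -- A non-integrable function would have Bochner integral 0 by convention, contradicting the
  -- positive value just computed.
  · by_contra h
    rw [integral_undef h] at hI
    exact (Real.rpow_pos_of_pos (by positivity) _).ne hI
  · exact Filter.Eventually.of_forall fun x => (Real.exp_pos _).le

theorem gaussMoment_ne_zero (n : ℕ) : gaussMoment n ≠ 0 := by
  intro h
  have := gaussMoment_mul_volume_ball n
  rw [h, zero_mul, eq_comm, ENNReal.ofReal_eq_zero] at this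
  exact absurd this (not_le.2 (Real.rpow_pos_of_pos (by positivity) _))

theorem gaussMoment_ne_top (n : ℕ) : gaussMoment n ≠ ⊤ := by
  intro h
  have := gaussMoment_mul_volume_ball n
  rw [h, ENNReal.top_mul (Metric.measure_ball_pos volume _ one_pos).ne'] at this
  exact ENNReal.ofReal_ne_top this.symm

theorem gaussMoment_mul_volume_ball_sq (n : ℕ) :
    (gaussMoment n * volume (Metric.ball (0 : EuclideanSpace ℝ (Fin n)) 1)) ^ 2 =
      ENNReal.ofReal ((2 * Real.pi) ^ n) := by
  rw [gaussMoment_mul_volume_ball, ← ENNReal.ofReal_pow (by positivity), ← Real.rpow_natCast,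
    ← Real.rpow_mul (by positivity)]
  congr 1
  rw [← Real.rpow_natCast]
  congr 1
  push_cast
  ring

/-- A cone is invariant under dilations, so cutting `φ` off to it preserves homogeneity. -/
theorem setLIntegral_mul_layer {n : ℕ} {A S : Set (EuclideanSpace ℝ (Fin n))}
    (hA : MeasurableSet A) (hS : MeasurableSet S) (hcone : ∀ r : ℝ, 0 < r → ∀ x, r • x ∈ S ↔ x ∈ S)
    {φ : EuclideanSpace ℝ (Fin n) → ℝ≥0∞} (hφ : Measurable φ) (k : ℕ)
    (hk : ∀ r : ℝ, 0 < r → ∀ x, φ (r • x) = ENNReal.ofReal (r ^ k) * φ x) :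
    ∫⁻ x in S, φ x * layer gaussWeight A x =
      gaussMoment (n + k) * ∫⁻ x in S, φ x * A.indicator 1 x := by
  have := lintegral_mul_layer measurable_gaussWeight hA (hφ.indicator hS) k (by
    intro r hr x
    by_cases hx : x ∈ S
    · rw [indicator_of_mem hx, indicator_of_mem ((hcone r hr x).2 hx), hk r hr]
    · rw [indicator_of_notMem hx, indicator_of_notMem (fun h => hx ((hcone r hr x).1 h)),
        mul_zero])
  rw [gaussMoment, ← lintegral_indicator hS, ← lintegral_indicator hS]
  rw [← lintegral_indicator hA] at this
  convert! this using 2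
  · ext x
    by_cases hx : x ∈ S <;> simp [hx]
  · refine lintegral_congr fun x => ?_
    by_cases hx : x ∈ S <;> by_cases hxA : x ∈ A <;> simp [hx, hxA]

/-- The positive and negative parts of a linear form are homogeneous of degree 1, so passing from
the set to its layer multiplies the moments over a cone by one constant. -/
theorem HasAxialMoment.layer {n : ℕ} {A S : Set (EuclideanSpace ℝ (Fin n))}
    {w : EuclideanSpace ℝ (Fin n)} (h : HasAxialMoment (A.indicator 1) S w)
    (hA : MeasurableSet A) (hS : MeasurableSet S)
    (hcone : ∀ r : ℝ, 0 < r → ∀ x, r • x ∈ S ↔ x ∈ S) :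
    HasAxialMoment (layer gaussWeight A) S w := by
  intro ℓ hℓ
  have e1 := setLIntegral_mul_layer hA hS hcone (φ := fun x => ENNReal.ofReal (inner ℝ ℓ x))
    (by fun_prop) 1 (by
      intro r hr x
      rw [inner_smul_right, ENNReal.ofReal_mul hr.le, pow_one])
  have e2 := setLIntegral_mul_layer hA hS hcone (φ := fun x => ENNReal.ofReal (-inner ℝ ℓ x))
    (by fun_prop) 1 (by
      intro r hr x
      rw [inner_smul_right, ← mul_neg, ENNReal.ofReal_mul hr.le, pow_one])
  obtain ⟨h1, h2⟩ := h ℓ hℓ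
  rw [e1, e2, h1]
  exact ⟨rfl, ENNReal.mul_ne_top (gaussMoment_ne_top _) (h1 ▸ h2)⟩

/-! ### The Meyer–Pajor inequality -/

theorem isClosed_polarAt {n : ℕ} (K : Set (EuclideanSpace ℝ (Fin n)))
    (x : EuclideanSpace ℝ (Fin n)) : IsClosed (polarAt K x) := by
  have : polarAt K x = ⋂ z ∈ K, {y | inner ℝ y (z - x) ≤ 1} := by
    ext y
    simp [polarAt]
  rw [this]
  exact isClosed_biInter fun z _ => isClosed_le (by fun_prop) continuous_const

/-- The Meyer–Pajor inequality: a hyperplane cutting a convex body contains a point of the body at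
which the volume product is controlled by the volumes of the two parts. -/
theorem exists_mem_hyperplane_volume_polarAt_le {n : ℕ} {K : Set (EuclideanSpace ℝ (Fin n))}
    (hK : IsCompact K) (hc : Convex ℝ K) {u : EuclideanSpace ℝ (Fin n)} (hu : ‖u‖ = 1) {a : ℝ}
    (hP : volume (K ∩ {y | a < inner ℝ y u}) ≠ 0) (hN : volume (K ∩ {y | inner ℝ y u < a}) ≠ 0) :
    ∃ z ∈ K, inner ℝ z u = a ∧
      4 * volume (K ∩ {y | a < inner ℝ y u}) * volume (K ∩ {y | inner ℝ y u < a}) *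
        volume (polarAt K z) ≤
      volume K * volume (Metric.ball (0 : EuclideanSpace ℝ (Fin n)) 1) ^ 2 := by
  obtain _ | m := n
  · exfalso
    rw [Subsingleton.elim u 0] at hu
    simp at hu
  have hKm : MeasurableSet K := hK.measurableSet
  have hmP : MeasurableSet {y : EuclideanSpace ℝ (Fin (m + 1)) | a < inner ℝ y u} :=
    measurableSet_lt measurable_const (by fun_prop)
  have hmN : MeasurableSet {y : EuclideanSpace ℝ (Fin (m + 1)) | inner ℝ y u < a} :=
    measurableSet_lt (by fun_prop) measurable_const
  have hind : Measurable (K.indicator (1 : EuclideanSpace ℝ (Fin (m + 1)) → ℝ≥0∞)) :=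
    measurable_one.indicator hKm
  have hν : volume.withDensity (K.indicator 1) = volume.restrict K := withDensity_indicator_one hKm
  have hfin : IsFiniteMeasure (volume.withDensity (K.indicator 1)) := by
    rw [hν]
    exact ⟨by simpa using hK.measure_lt_top⟩
  have hKae : ∀ᵐ y ∂(volume.withDensity (K.indicator 1)), y ∈ K := by
    rw [hν]; exact ae_restrict_mem hKm
  obtain ⟨R, hR⟩ := hK.isBounded.exists_norm_le
  have hRae : ∀ᵐ y ∂(volume.withDensity (K.indicator 1)), ‖y‖ ≤ R := by
    filter_upwards [hKae] with y hy using hR y hy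
  obtain ⟨z, w, hzu, hwu, hax, hmem⟩ := exists_center (u := u) (a := a) hRae
    (by rw [hν, Measure.restrict_apply hmP, inter_comm]; exact hP)
    (by rw [hν, Measure.restrict_apply hmN, inter_comm]; exact hN)
  refine ⟨z, hmem K hc hK.isClosed hKae, hzu, ?_⟩
  have tP : {p : EuclideanSpace ℝ (Fin (m + 1)) | 0 < inner ℝ p u} =
      (fun p => p + z) ⁻¹' {y | a < inner ℝ y u} := by
    ext p
    simp [inner_add_left, hzu]
  have tN : {p : EuclideanSpace ℝ (Fin (m + 1)) | inner ℝ p u < 0} =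
      (fun p => p + z) ⁻¹' {y | inner ℝ y u < a} := by
    ext p
    simp [inner_add_left, hzu]
  set A := (fun p => p + z) ⁻¹' K with hA
  have hAm : MeasurableSet A := hKm.preimage (by fun_prop)
  have hAind : (fun p => K.indicator (1 : EuclideanSpace ℝ (Fin (m + 1)) → ℝ≥0∞) (p + z)) =
      A.indicator 1 := rfl
  have aP := hasAxialMoment_translate hind hRae hmP (fun ℓ hℓ => (hax ℓ hℓ).1) tP
  have aN := hasAxialMoment_translate hind hRae hmN (fun ℓ hℓ => (hax ℓ hℓ).2) tN
  rw [hAind] at aP aN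
  have mP : MeasurableSet {p : EuclideanSpace ℝ (Fin (m + 1)) | 0 < inner ℝ p u} :=
    measurableSet_lt measurable_const (by fun_prop)
  have mN : MeasurableSet {p : EuclideanSpace ℝ (Fin (m + 1)) | inner ℝ p u < 0} :=
    measurableSet_lt (by fun_prop) measurable_const
  have cP : ∀ r : ℝ, 0 < r → ∀ x : EuclideanSpace ℝ (Fin (m + 1)),
      r • x ∈ {p | 0 < inner ℝ p u} ↔ x ∈ {p | 0 < inner ℝ p u} := by
    intro r hr x
    simp [inner_smul_left, hr]
  have cN : ∀ r : ℝ, 0 < r → ∀ x : EuclideanSpace ℝ (Fin (m + 1)),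
      r • x ∈ {p | inner ℝ p u < 0} ↔ x ∈ {p | inner ℝ p u < 0} := by
    intro r hr x
    simp only [mem_ofPred_eq, inner_smul_left, RCLike.conj_to_real, mul_neg_iff]
    constructor
    · rintro (h | h)
      · exact h.2
      · linarith [h.1]
    · exact fun h => Or.inl ⟨hr, h⟩
  have hBm : MeasurableSet (polarAt K z) := (isClosed_polarAt K z).measurableSet
  have hsplit := (functionalSantalo m).split (measurable_layer measurable_gaussWeight hAm)
    (measurable_layer measurable_gaussWeight hBm)
    (layer_gaussWeight_mul_le (A := A) (B := polarAt K z) (by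
      intro x hx y hy
      have := hy _ hx
      simp only [add_sub_cancel_right] at this
      rwa [real_inner_comm])) hu hwu (aP.layer hAm mP cP) (aN.layer hAm mN cN)
  have vol : ∀ S T : Set (EuclideanSpace ℝ (Fin (m + 1))), MeasurableSet T →
      S = (fun p => p + z) ⁻¹' T →
      MeasurableSet S → (∀ r : ℝ, 0 < r → ∀ x, r • x ∈ S ↔ x ∈ S) →
      ∫⁻ x in S, layer gaussWeight A x = gaussMoment (m + 1) * volume (K ∩ T) := by
    intro S T hT hST hS hcone
    have := setLIntegral_mul_layer hAm hS hcone (φ := fun _ => 1) measurable_const 0 (by simp)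
    simp only [one_mul, add_zero] at this
    rw [this, lintegral_indicator_one hAm, Measure.restrict_apply hAm, hST, hA, ← preimage_inter,
      measure_preimage_add_right]
  rw [vol _ _ hmP tP mP cP, vol _ _ hmN tN mN cN, lintegral_layer hAm, lintegral_layer hBm, hA,
    measure_preimage_add_right, ENNReal.ofReal_div_of_pos (by norm_num),
    ← gaussMoment_mul_volume_ball_sq] at hsplit
  set c := gaussMoment (m + 1) with hcdef
  have hc0 : c ≠ 0 := gaussMoment_ne_zero _
  have hct : c ≠ ⊤ := gaussMoment_ne_top _
  set α := volume (K ∩ {y | a < inner ℝ y u})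
  set β := volume (K ∩ {y | inner ℝ y u < a})
  set γ := volume (polarAt K z)
  set V := volume (Metric.ball (0 : EuclideanSpace ℝ (Fin (m + 1))) 1)
  have h4 : ENNReal.ofReal 4 = 4 := by simp
  rw [h4] at hsplit
  -- Each volume turned into a layer integral carries one factor `c`, and the constant `(2π)^(m+1)`
  -- equals `(cV)²`. Both sides therefore contain `c³`, which cancels.
  have e1 : c ^ 3 * (4 * α * β * γ) = 4 * (c * α * (c * β) * (c * γ)) := by ring
  have e2 : c ^ 3 * (volume K * V ^ 2) = 4 * (c * volume K * ((c * V) ^ 2 / 4)) := by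
    have : 4 * ((c * V) ^ 2 / 4) = (c * V) ^ 2 := ENNReal.mul_div_cancel (by simp) (by simp)
    calc c ^ 3 * (volume K * V ^ 2) = c * volume K * (c * V) ^ 2 := by ring
      _ = c * volume K * (4 * ((c * V) ^ 2 / 4)) := by rw [this]
      _ = _ := by ring
  refine (ENNReal.mul_le_mul_iff_right (pow_ne_zero 3 hc0) (ENNReal.pow_ne_top hct)).1 ?_
  rw [e1, e2]
  gcongr

/-! ### Volumes of polar bodies as Laplace transforms -/

/-- The support function of a set. -/
noncomputable def supportFn {n : ℕ} (K : Set (EuclideanSpace ℝ (Fin n)))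
    (y : EuclideanSpace ℝ (Fin n)) : ℝ :=
  sSup ((fun z => inner ℝ y z) '' K)

section SupportFn

variable {n : ℕ} {K : Set (EuclideanSpace ℝ (Fin n))}

theorem continuous_supportFn (hK : IsCompact K) : Continuous (supportFn K) :=
  hK.continuous_sSup (f := fun y z => inner ℝ y z) continuous_inner

theorem inner_le_supportFn (hK : IsCompact K) {z : EuclideanSpace ℝ (Fin n)} (hz : z ∈ K)
    (y : EuclideanSpace ℝ (Fin n)) : inner ℝ y z ≤ supportFn K y :=
  le_csSup (hK.image (by fun_prop)).bddAbove ⟨z, hz, rfl⟩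

theorem supportFn_le_iff (hK : IsCompact K) (hne : K.Nonempty) {y : EuclideanSpace ℝ (Fin n)}
    {c : ℝ} : supportFn K y ≤ c ↔ ∀ z ∈ K, inner ℝ y z ≤ c := by
  refine ⟨fun h z hz => (inner_le_supportFn hK hz y).trans h, fun h => ?_⟩
  refine csSup_le (hne.image _) ?_
  rintro _ ⟨z, hz, rfl⟩
  exact h z hz

/-- Tested on the point `x + ε y/‖y‖`. This is the source of the decay `exp(-ε‖y‖)` of the Laplace
integrand at interior points. -/
theorem inner_add_mul_norm_le_supportFn (hK : IsCompact K) {x : EuclideanSpace ℝ (Fin n)} {ε : ℝ}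
    (hε : 0 ≤ ε) (h : Metric.closedBall x ε ⊆ K) (y : EuclideanSpace ℝ (Fin n)) :
    inner ℝ x y + ε * ‖y‖ ≤ supportFn K y := by
  rcases eq_or_ne y 0 with rfl | hy
  · have := inner_le_supportFn hK (h (Metric.mem_closedBall_self hε)) 0
    simpa using this
  have hy' : ‖y‖ ≠ 0 := norm_ne_zero_iff.2 hy
  have hm : x + (ε * ‖y‖⁻¹) • y ∈ K := by
    refine h ?_
    rw [mem_closedBall_iff_norm, add_sub_cancel_left, norm_smul, Real.norm_of_nonneg (by positivity)]
    rw [mul_assoc, inv_mul_cancel₀ hy', mul_one]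
  have := inner_le_supportFn hK hm y
  rw [inner_add_right, inner_smul_right, real_inner_self_eq_norm_sq, real_inner_comm] at this
  convert! this using 2
  field_simp

/-- The Laplace transform of `exp (-h_K)`. -/
noncomputable def laplace (K : Set (EuclideanSpace ℝ (Fin n))) (x : EuclideanSpace ℝ (Fin n)) :
    ℝ≥0∞ :=
  ∫⁻ y, ENNReal.ofReal (Real.exp (inner ℝ x y - supportFn K y))

/-- The radial moment of the exponential weight. -/
noncomputable def expMoment (n : ℕ) : ℝ≥0∞ :=
  ∫⁻ r in Ioi (0 : ℝ), ENNReal.ofReal (r ^ n) * ENNReal.ofReal (Real.exp (-r))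

theorem expMoment_eq (n : ℕ) : expMoment n = ENNReal.ofReal (Real.Gamma (n + 1)) := by
  rw [Real.Gamma_eq_integral (by positivity), ofReal_integral_eq_lintegral_ofReal
    (Real.GammaIntegral_convergent (by positivity))]
  · refine setLIntegral_congr_fun measurableSet_Ioi fun r hr => ?_
    have hr : 0 < r := hr
    rw [← ENNReal.ofReal_mul (by positivity), add_sub_cancel_right, Real.rpow_natCast, mul_comm]
  · filter_upwards [ae_restrict_mem measurableSet_Ioi] with r hr
    have hr : 0 < r := hr
    exact mul_nonneg (Real.exp_pos _).le (Real.rpow_nonneg hr.le _)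

theorem expMoment_ne_zero (n : ℕ) : expMoment n ≠ 0 := by
  rw [expMoment_eq, Ne, ENNReal.ofReal_eq_zero, not_le]
  exact Real.Gamma_pos_of_pos (by positivity)

theorem expMoment_ne_top (n : ℕ) : expMoment n ≠ ⊤ := by
  rw [expMoment_eq]
  exact ENNReal.ofReal_ne_top

/-- The integrand `exp(-(h_K(y) - ⟪x, y⟫))` is the integral of `exp(-r)` over `r > h_K(y) - ⟪x, y⟫`,
and `y/r` lies in the polar body exactly when `r ≥ h_K(y) - ⟪x, y⟫`. So it is the layer of the polar
body with weight `exp(-r)`. Since `x ∈ K` the threshold is nonnegative, and restricting to `r > 0`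
loses nothing. -/
theorem expMoment_mul_volume_polarAt (hK : IsCompact K) {x : EuclideanSpace ℝ (Fin n)}
    (hx : x ∈ K) : expMoment n * volume (polarAt K x) = laplace K x := by
  have hκ : Measurable fun r : ℝ => ENNReal.ofReal (Real.exp (-r)) := by fun_prop
  have := lintegral_mul_layer hκ (isClosed_polarAt K x).measurableSet (φ := fun _ => 1)
    measurable_const 0 (by simp)
  simp only [one_mul, add_zero, lintegral_const, Measure.restrict_apply MeasurableSet.univ,
    univ_inter] at this
  rw [expMoment, ← this, laplace]
  refine lintegral_congr fun y => ?_
  have h0 : 0 ≤ supportFn K y - inner ℝ x y := by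
    rw [real_inner_comm]
    exact sub_nonneg.2 (inner_le_supportFn hK hx y)
  have hI : ∫⁻ r in Ioi (supportFn K y - inner ℝ x y), ENNReal.ofReal (Real.exp (-r)) =
      ENNReal.ofReal (Real.exp (inner ℝ x y - supportFn K y)) := by
    rw [← neg_sub (supportFn K y), ← integral_exp_neg_Ioi,
      ofReal_integral_eq_lintegral_ofReal (integrableOn_exp_neg_Ioi _)]
    exact Filter.Eventually.of_forall fun r => (Real.exp_pos _).le
  rw [← hI, layer, ← lintegral_indicator measurableSet_Ioi, ← lintegral_indicator measurableSet_Ioi]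
  refine lintegral_congr_ae ?_
  -- The threshold itself is discarded, since there the weak and the strict inequality disagree.
  filter_upwards [compl_mem_ae_iff.2 (measure_singleton (supportFn K y - inner ℝ x y))] with r hr
  by_cases hr0 : r ∈ Ioi (0 : ℝ)
  · have hr0' : 0 < r := hr0
    have key : r⁻¹ • y ∈ polarAt K x ↔ r ∈ Ioi (supportFn K y - inner ℝ x y) := by
      have h1 : r⁻¹ • y ∈ polarAt K x ↔ ∀ z ∈ K, inner ℝ y z ≤ r + inner ℝ x y := by
        refine forall₂_congr fun z _ => ?_
        rw [inner_smul_left, RCLike.conj_to_real, inv_mul_le_iff₀ hr0', mul_one, inner_sub_right,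
          real_inner_comm x y, sub_le_iff_le_add]
      have hr : r ≠ supportFn K y - inner ℝ x y := hr
      rw [h1, ← supportFn_le_iff hK ⟨x, hx⟩, mem_Ioi, ← sub_le_iff_le_add]
      exact ⟨fun h => lt_of_le_of_ne h hr.symm, le_of_lt⟩
    rw [indicator_of_mem hr0]
    by_cases h : r⁻¹ • y ∈ polarAt K x
    · rw [indicator_of_mem (key.1 h), indicator_of_mem h]; simp
    · rw [indicator_of_notMem (key.not.1 h), indicator_of_notMem h]; simp
  · have : r ∉ Ioi (supportFn K y - inner ℝ x y) := fun h => hr0 (lt_of_le_of_lt h0 h)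
    rw [indicator_of_notMem hr0, indicator_of_notMem this]

/-- A supporting functional at `x` gives `v ≠ 0` with `⟪v, z - x⟫ ≤ 0` on `K`. The polar body then
contains a ball of radius `1/R` about every nonnegative multiple of `v`, hence infinitely many
disjoint balls of equal volume. -/
theorem volume_polarAt_eq_top (hK : IsCompact K) (hc : Convex ℝ K) (hne : (interior K).Nonempty)
    {x : EuclideanSpace ℝ (Fin n)} (hx : x ∉ interior K) : volume (polarAt K x) = ⊤ := by
  obtain ⟨f, hf⟩ := geometric_hahn_banach_open_point hc.interior isOpen_interior hx
  set v := (InnerProductSpace.toDual ℝ _).symm f with hv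
  have hfv : ∀ y, f y = inner ℝ v y := fun y => by
    rw [hv, InnerProductSpace.toDual_symm_apply]
  have hv0 : v ≠ 0 := by
    intro h
    obtain ⟨y, hy⟩ := hne
    have := hf y hy
    rw [hfv, hfv, h] at this
    simp at this
  have hle : ∀ z ∈ K, inner ℝ v (z - x) ≤ 0 := by
    intro z hz
    have hz' : z ∈ closure (interior K) := by
      rw [hc.closure_interior_eq_closure_of_nonempty_interior hne]
      exact subset_closure hz
    have : interior K ⊆ {z | inner ℝ v (z - x) ≤ 0} := by
      intro y hy
      have := hf y hy
      rw [hfv, hfv] at this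
      simp only [mem_ofPred_eq, inner_sub_right]
      linarith
    exact closure_minimal this (isClosed_le (by fun_prop) continuous_const) hz'
  obtain ⟨R, hR0, hR⟩ : ∃ R : ℝ, 0 < R ∧ ∀ z ∈ K, ‖z - x‖ ≤ R := by
    obtain ⟨R, hR⟩ := hK.isBounded.exists_norm_le
    refine ⟨|R| + ‖x‖ + 1, by positivity, fun z hz => ?_⟩
    have := norm_sub_le z x
    have := hR z hz
    have := le_abs_self R
    linarith
  set ρ := R⁻¹ with hρ
  have hρ0 : 0 < ρ := inv_pos.2 hR0
  have hvn : 0 < ‖v‖ := norm_pos_iff.2 hv0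
  let c : ℕ → EuclideanSpace ℝ (Fin n) := fun k => (k * (2 * ρ * ‖v‖⁻¹)) • v
  have hsub : (⋃ k, Metric.ball (c k) ρ) ⊆ polarAt K x := by
    refine iUnion_subset fun k y hy z hz => ?_
    have e : inner ℝ y (z - x) = inner ℝ (y - c k) (z - x) + inner ℝ (c k) (z - x) := by
      rw [← inner_add_left, sub_add_cancel]
    have h1 : inner ℝ (y - c k) (z - x) ≤ 1 := by
      refine (real_inner_le_norm _ _).trans ?_
      rw [mem_ball_iff_norm] at hy
      calc ‖y - c k‖ * ‖z - x‖ ≤ ρ * R := by gcongr; exact hR z hz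
        _ = 1 := inv_mul_cancel₀ hR0.ne'
    have h2 : inner ℝ (c k) (z - x) ≤ 0 := by
      simp only [c, inner_smul_left, RCLike.conj_to_real]
      exact mul_nonpos_of_nonneg_of_nonpos (by positivity) (hle z hz)
    linarith
  have hdisj : Pairwise (Function.onFun Disjoint fun k => Metric.ball (c k) ρ) := by
    intro k l hkl
    refine Metric.ball_disjoint_ball ?_
    have : dist (c k) (c l) = |(k : ℝ) - l| * (2 * ρ) := by
      rw [dist_eq_norm, ← sub_smul, norm_smul, Real.norm_eq_abs, ← sub_mul, abs_mul,
        abs_of_pos (show 0 < 2 * ρ * ‖v‖⁻¹ by positivity)]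
      field_simp
    rw [this]
    have h1 : (1 : ℝ) ≤ |(k : ℝ) - l| := by
      have : (1 : ℤ) ≤ |(k : ℤ) - l| := Int.one_le_abs (sub_ne_zero.2 (by exact_mod_cast hkl))
      exact_mod_cast this
    nlinarith
  have htop : volume (⋃ k, Metric.ball (c k) ρ) = ⊤ := by
    rw [measure_iUnion hdisj fun k => Metric.isOpen_ball.measurableSet]
    have : ∀ k, volume (Metric.ball (c k) ρ) =
        volume (Metric.ball (0 : EuclideanSpace ℝ (Fin n)) ρ) := fun k =>
      Measure.addHaar_ball_center _ _ _
    simp only [this]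
    exact ENNReal.tsum_const_eq_top_of_ne_zero (Metric.measure_ball_pos _ _ hρ0).ne'
  exact top_le_iff.1 (htop ▸ measure_mono hsub)

end SupportFn

/-! ### Smoothness and strict convexity of the Laplace transform -/

/-- The bound `s^N / N! ≤ exp s` with `N = k + n + 1` trades the exponential for a multiple of the
integrable power `(1 + ‖y‖)^(-(n+1))`. -/
theorem integrable_one_add_norm_pow_mul_exp {n : ℕ} (k : ℕ) {ε : ℝ} (hε : 0 < ε) :
    Integrable fun y : EuclideanSpace ℝ (Fin n) => (1 + ‖y‖) ^ k * Real.exp (-(ε * ‖y‖)) := by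
  have h1 : Integrable fun y : EuclideanSpace ℝ (Fin n) => (1 + ‖y‖) ^ (-((n + 1 : ℕ) : ℝ)) :=
    integrable_one_add_norm (by simp)
  set N := k + (n + 1) with hN
  refine (h1.const_mul (Real.exp ε * (N.factorial / ε ^ N))).mono' (by fun_prop) ?_
  refine Filter.Eventually.of_forall fun y => ?_
  have hs : 0 < 1 + ‖y‖ := by positivity
  have key := Real.pow_div_factorial_le_exp (ε * (1 + ‖y‖)) (by positivity) N
  rw [Real.norm_of_nonneg (by positivity), Real.rpow_neg hs.le, Real.rpow_natCast]
  have e : Real.exp (-(ε * ‖y‖)) = Real.exp ε / Real.exp (ε * (1 + ‖y‖)) := by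
    rw [← Real.exp_sub]; congr 1; ring
  have hf : (0 : ℝ) < N.factorial := by positivity
  rw [e, ← div_eq_mul_inv, le_div_iff₀ (by positivity)]
  rw [div_le_iff₀ hf, mul_pow] at key
  have hE : 0 < Real.exp (ε * (1 + ‖y‖)) := Real.exp_pos _
  calc (1 + ‖y‖) ^ k * (Real.exp ε / Real.exp (ε * (1 + ‖y‖))) * (1 + ‖y‖) ^ (n + 1)
      = Real.exp ε * ((1 + ‖y‖) ^ N / Real.exp (ε * (1 + ‖y‖))) := by
        rw [hN, pow_add]; ring
    _ ≤ Real.exp ε * (N.factorial / ε ^ N) := by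
        gcongr ?_ * ?_
        rw [div_le_div_iff₀ hE (by positivity)]
        linarith

section Laplace

variable {n : ℕ} {K : Set (EuclideanSpace ℝ (Fin n))}
  {F : Type} [NormedAddCommGroup F] [NormedSpace ℝ F]

theorem exp_inner_sub_supportFn_le (hK : IsCompact K) {x : EuclideanSpace ℝ (Fin n)} {ε : ℝ}
    (hε : 0 ≤ ε) (h : Metric.closedBall x ε ⊆ K) (y : EuclideanSpace ℝ (Fin n)) :
    Real.exp (inner ℝ x y - supportFn K y) ≤ Real.exp (-(ε * ‖y‖)) := by
  apply Real.exp_le_exp.2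
  linarith [inner_add_mul_norm_le_supportFn hK hε h y]

theorem integrable_exp_smul (hK : IsCompact K) {x : EuclideanSpace ℝ (Fin n)}
    (hx : x ∈ interior K) {P : EuclideanSpace ℝ (Fin n) → F} (hP : Continuous P) {C : ℝ} {k : ℕ}
    (hC : ∀ y, ‖P y‖ ≤ C * (1 + ‖y‖) ^ k) :
    Integrable fun y => Real.exp (inner ℝ x y - supportFn K y) • P y := by
  have hh := continuous_supportFn hK
  obtain ⟨ε, hε, hb⟩ := Metric.nhds_basis_closedBall.mem_iff.1 (mem_interior_iff_mem_nhds.1 hx)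
  refine ((integrable_one_add_norm_pow_mul_exp k hε).const_mul C).mono'
    (Continuous.aestronglyMeasurable (by fun_prop)) (Filter.Eventually.of_forall fun y => ?_)
  rw [norm_smul, Real.norm_of_nonneg (Real.exp_pos _).le]
  calc _ ≤ Real.exp (-(ε * ‖y‖)) * (C * (1 + ‖y‖) ^ k) := by
        exact mul_le_mul (exp_inner_sub_supportFn_le hK hε.le hb y) (hC y) (norm_nonneg _)
          (Real.exp_pos _).le
    _ = _ := by ring

theorem norm_inner_smulRight_le {P : EuclideanSpace ℝ (Fin n) → F} {C : ℝ} {k : ℕ}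
    (hC : ∀ y, ‖P y‖ ≤ C * (1 + ‖y‖) ^ k) (y : EuclideanSpace ℝ (Fin n)) :
    ‖(innerSL ℝ y).smulRight (P y)‖ ≤ C * (1 + ‖y‖) ^ (k + 1) := by
  rw [ContinuousLinearMap.norm_smulRight_apply, innerSL_apply_norm, pow_succ]
  have h0 := (norm_nonneg (P y)).trans (hC y)
  calc ‖y‖ * ‖P y‖ ≤ (1 + ‖y‖) * (C * (1 + ‖y‖) ^ k) := by
        gcongr
        · linarith
        · exact hC y
    _ = _ := by ring

/-- Differentiation under the integral: for base points within `ε/2` of `x` the integrand still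
decays like `exp(-ε‖y‖/2)`. A vector-valued `P` of polynomial growth makes the derivative an
integral of the same shape, with growth one degree higher, which is what lets the induction for
smoothness run. -/
theorem hasFDerivAt_integral_exp_smul (hK : IsCompact K) {x : EuclideanSpace ℝ (Fin n)}
    (hx : x ∈ interior K) {P : EuclideanSpace ℝ (Fin n) → F} (hP : Continuous P) {C : ℝ} {k : ℕ}
    (hC : ∀ y, ‖P y‖ ≤ C * (1 + ‖y‖) ^ k) :
    HasFDerivAt (fun x => ∫ y, Real.exp (inner ℝ x y - supportFn K y) • P y)
      (∫ y, Real.exp (inner ℝ x y - supportFn K y) • (innerSL ℝ y).smulRight (P y)) x := by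
  have hh := continuous_supportFn hK
  obtain ⟨ε, hε, hb⟩ := Metric.nhds_basis_closedBall.mem_iff.1 (mem_interior_iff_mem_nhds.1 hx)
  have hP' : Continuous fun y => (innerSL ℝ y).smulRight (P y) := by fun_prop
  refine hasFDerivAt_integral_of_dominated_of_fderiv_le
    (F' := fun x y => Real.exp (inner ℝ x y - supportFn K y) • (innerSL ℝ y).smulRight (P y))
    (bound := fun y => C * ((1 + ‖y‖) ^ (k + 1) * Real.exp (-((ε / 2) * ‖y‖))))
    (Metric.ball_mem_nhds x (half_pos hε))
    (Filter.Eventually.of_forall fun x' => Continuous.aestronglyMeasurable (by fun_prop))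
    (integrable_exp_smul hK hx hP hC) (Continuous.aestronglyMeasurable (by fun_prop))
    (Filter.Eventually.of_forall fun y x' hx' => ?_)
    ((integrable_one_add_norm_pow_mul_exp (k + 1) (half_pos hε)).const_mul C)
    (Filter.Eventually.of_forall fun y x' hx' => ?_)
  · have hb' : Metric.closedBall x' (ε / 2) ⊆ K := by
      refine (Metric.closedBall_subset_closedBall' ?_).trans hb
      have := Metric.mem_ball.1 hx'
      linarith
    rw [norm_smul, Real.norm_of_nonneg (Real.exp_pos _).le]
    calc _ ≤ Real.exp (-((ε / 2) * ‖y‖)) * (C * (1 + ‖y‖) ^ (k + 1)) := by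
          exact mul_le_mul (exp_inner_sub_supportFn_le hK (half_pos hε).le hb' y)
            (norm_inner_smulRight_le hC y) (norm_nonneg _) (Real.exp_pos _).le
      _ = _ := by ring
  · have h1 : HasFDerivAt (fun x : EuclideanSpace ℝ (Fin n) => inner ℝ x y - supportFn K y)
        (innerSL ℝ y) x' := by
      have : (fun x : EuclideanSpace ℝ (Fin n) => inner ℝ x y - supportFn K y) =
          fun x => innerSL ℝ y x - supportFn K y := by
        ext x; rw [innerSL_apply_apply, real_inner_comm]
      rw [this]
      exact (innerSL ℝ y).hasFDerivAt.sub_const _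
    convert! h1.exp.smul_const (P y) using 1
    ext v
    simp [smul_smul]

theorem contDiffOn_integral_exp_smul_nat (hK : IsCompact K) (m : ℕ) :
    ∀ (F : Type) [NormedAddCommGroup F] [NormedSpace ℝ F] (P : EuclideanSpace ℝ (Fin n) → F),
      Continuous P → ∀ (C : ℝ) (k : ℕ), (∀ y, ‖P y‖ ≤ C * (1 + ‖y‖) ^ k) →
      ContDiffOn ℝ m (fun x => ∫ y, Real.exp (inner ℝ x y - supportFn K y) • P y)
        (interior K) := by
  induction m with
  | zero =>
    intro F _ _ P hP C k hC
    rw [Nat.cast_zero, contDiffOn_zero]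
    exact fun x hx =>
      (hasFDerivAt_integral_exp_smul hK hx hP hC).continuousAt.continuousWithinAt
  | succ m ih =>
    intro F _ _ P hP C k hC
    rw [Nat.cast_succ, contDiffOn_succ_iff_fderiv_of_isOpen isOpen_interior]
    refine ⟨fun x hx => (hasFDerivAt_integral_exp_smul hK hx hP
      hC).differentiableAt.differentiableWithinAt, by simp, ?_⟩
    refine (ih _ (fun y => (innerSL ℝ y).smulRight (P y)) (by fun_prop) C (k + 1)
      (norm_inner_smulRight_le hC)).congr fun x hx => ?_
    exact (hasFDerivAt_integral_exp_smul hK hx hP hC).fderiv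

theorem integrable_exp_inner_sub_supportFn (hK : IsCompact K) {x : EuclideanSpace ℝ (Fin n)}
    (hx : x ∈ interior K) : Integrable fun y => Real.exp (inner ℝ x y - supportFn K y) := by
  have := integrable_exp_smul hK hx (P := fun _ => (1 : ℝ)) continuous_const (C := 1) (k := 0)
    (by simp)
  simpa using this

theorem contDiffOn_integral_exp (hK : IsCompact K) :
    ContDiffOn ℝ ∞ (fun x => ∫ y, Real.exp (inner ℝ x y - supportFn K y)) (interior K) := by
  rw [contDiffOn_infty]
  intro m
  have := contDiffOn_integral_exp_smul_nat hK m ℝ (fun _ => (1 : ℝ)) continuous_const 1 0 (by simp)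
  simpa using this

theorem laplace_eq_ofReal (hK : IsCompact K) {x : EuclideanSpace ℝ (Fin n)}
    (hx : x ∈ interior K) :
    laplace K x = ENNReal.ofReal (∫ y, Real.exp (inner ℝ x y - supportFn K y)) := by
  rw [ofReal_integral_eq_lintegral_ofReal (integrable_exp_inner_sub_supportFn hK hx)
    (Filter.Eventually.of_forall fun y => (Real.exp_pos _).le)]
  rfl

theorem integral_exp_inner_sub_supportFn_pos (hK : IsCompact K) {x : EuclideanSpace ℝ (Fin n)}
    (hx : x ∈ interior K) : 0 < ∫ y, Real.exp (inner ℝ x y - supportFn K y) :=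
  integral_exp_pos (integrable_exp_inner_sub_supportFn hK hx)

/-- For each `v` off the null hyperplane orthogonal to `x - y` the two exponents differ, so strict
convexity of `exp` gives a pointwise strict inequality almost everywhere. -/
theorem strictConvexOn_integral_exp (hK : IsCompact K) (hc : Convex ℝ K) :
    StrictConvexOn ℝ (interior K)
      (fun x => ∫ y, Real.exp (inner ℝ x y - supportFn K y)) := by
  refine ⟨hc.interior, fun x hx y hy hxy a b ha hb hab => ?_⟩
  have hz := hc.interior hx hy ha.le hb.le hab
  have ix := integrable_exp_inner_sub_supportFn hK hx
  have iy := integrable_exp_inner_sub_supportFn hK hy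
  have iz := integrable_exp_inner_sub_supportFn hK hz
  have isum : Integrable fun v => a * Real.exp (inner ℝ x v - supportFn K v) +
      b * Real.exp (inner ℝ y v - supportFn K v) := (ix.const_mul a).add (iy.const_mul b)
  simp only [smul_eq_mul]
  rw [← integral_const_mul, ← integral_const_mul, ← integral_add (ix.const_mul a) (iy.const_mul b),
    ← sub_pos, ← integral_sub isum iz]
  have e : ∀ v, inner ℝ (a • x + b • y) v - supportFn K v =
      a • (inner ℝ x v - supportFn K v) + b • (inner ℝ y v - supportFn K v) := by
    intro v
    rw [inner_add_left, inner_smul_left, inner_smul_left]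
    simp only [RCLike.conj_to_real, smul_eq_mul]
    have : supportFn K v = (a + b) * supportFn K v := by rw [hab, one_mul]
    nth_rewrite 1 [this]
    ring
  have hlt : ∀ v, v ∉ {v | inner ℝ v (x - y) = 0} →
      0 < (a * Real.exp (inner ℝ x v - supportFn K v) + b * Real.exp (inner ℝ y v - supportFn K v))
        - Real.exp (inner ℝ (a • x + b • y) v - supportFn K v) := by
    intro v hv
    rw [e, sub_pos]
    refine strictConvexOn_exp.2 (mem_univ _) (mem_univ _) (fun h => hv ?_) ha hb hab
    simp only [mem_ofPred_eq, inner_sub_right]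
    rw [real_inner_comm x v, real_inner_comm y v]
    linarith
  have hnull := volume_inner_eq_zero (sub_ne_zero.2 hxy)
  rw [integral_pos_iff_support_of_nonneg_ae]
  · refine lt_of_lt_of_le ?_ (measure_mono
      (show {v | inner ℝ v (x - y) = 0}ᶜ ⊆ _ from fun v hv => (hlt v hv).ne'))
    rw [measure_compl₀ (NullMeasurableSet.of_null hnull) (by rw [hnull]; simp), hnull, tsub_zero]
    exact Measure.measure_univ_pos.2 (NeZero.ne _)
  · filter_upwards [compl_mem_ae_iff.2 hnull] with v hv using (hlt v hv).le
  · exact isum.sub iz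

/-- Fatou's lemma: lower semicontinuity holds on the whole space, including where the transform is
infinite. -/
theorem isClosed_laplace_le (hK : IsCompact K) (T : ℝ≥0∞) :
    IsClosed {x | laplace K x ≤ T} := by
  have hh := continuous_supportFn hK
  refine IsSeqClosed.isClosed fun u x hu hx => ?_
  have : ∀ y, ENNReal.ofReal (Real.exp (inner ℝ x y - supportFn K y)) =
      Filter.liminf (fun k => ENNReal.ofReal (Real.exp (inner ℝ (u k) y - supportFn K y)))
        Filter.atTop := by
    intro y
    refine (Filter.Tendsto.liminf_eq ?_).symm
    have hc : Continuous fun x : EuclideanSpace ℝ (Fin n) =>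
        ENNReal.ofReal (Real.exp (inner ℝ x y - supportFn K y)) :=
      ENNReal.continuous_ofReal.comp (by fun_prop)
    exact (hc.tendsto x).comp hx
  simp only [mem_ofPred_eq, laplace, this]
  refine (lintegral_liminf_le fun k => by fun_prop).trans ?_
  refine (Filter.liminf_le_liminf (Filter.Eventually.of_forall hu)).trans ?_
  simp

end Laplace

/-! ### Santaló regions as sublevel sets -/

section Regions

variable {n : ℕ} {K : Set (EuclideanSpace ℝ (Fin n))}

theorem volume_ball_sq_ne_zero (n : ℕ) :
    volume (Metric.ball (0 : EuclideanSpace ℝ (Fin n)) 1) ^ 2 ≠ 0 :=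
  pow_ne_zero 2 (Metric.measure_ball_pos volume _ one_pos).ne'

theorem volume_ball_sq_ne_top (n : ℕ) :
    volume (Metric.ball (0 : EuclideanSpace ℝ (Fin n)) 1) ^ 2 ≠ ⊤ :=
  ENNReal.pow_ne_top measure_ball_lt_top.ne

theorem volume_ne_zero_of_interior_nonempty (hne : (interior K).Nonempty) : volume K ≠ 0 :=
  (Measure.measure_pos_of_nonempty_interior volume hne).ne'

theorem exists_santaloRegion_eq_laplace (hK : IsCompact K) (hne : (interior K).Nonempty) :
    ∃ k : ℝ, 0 < k ∧ ∀ t, santaloRegion K t =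
      {x | x ∈ K ∧ ENNReal.ofReal k * laplace K x ≤ ENNReal.ofReal t} := by
  set V := volume (Metric.ball (0 : EuclideanSpace ℝ (Fin n)) 1) with hV
  set κ := volume K / (V ^ 2 * expMoment n) with hκ
  have hκ0 : κ ≠ 0 := ENNReal.div_ne_zero.2 ⟨volume_ne_zero_of_interior_nonempty hne,
    ENNReal.mul_ne_top (volume_ball_sq_ne_top n) (expMoment_ne_top n)⟩
  have hκt : κ ≠ ⊤ := ENNReal.div_ne_top hK.measure_lt_top.ne
    (mul_ne_zero (volume_ball_sq_ne_zero n) (expMoment_ne_zero n))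
  refine ⟨κ.toReal, ENNReal.toReal_pos hκ0 hκt, fun t => ?_⟩
  ext x
  refine and_congr_right fun hx => ?_
  rw [ENNReal.ofReal_toReal hκt, ← expMoment_mul_volume_polarAt hK hx, hκ]
  have : volume K / (V ^ 2 * expMoment n) * (expMoment n * volume (polarAt K x)) =
      volume K * volume (polarAt K x) / V ^ 2 := by
    rw [div_eq_mul_inv, ENNReal.mul_inv (Or.inl (volume_ball_sq_ne_zero n))
      (Or.inl (volume_ball_sq_ne_top n)), div_eq_mul_inv]
    calc _ = volume K * volume (polarAt K x) * (V ^ 2)⁻¹ * ((expMoment n)⁻¹ * expMoment n) := by ring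
      _ = _ := by rw [ENNReal.inv_mul_cancel (expMoment_ne_zero n) (expMoment_ne_top n), mul_one]
  rw [this]

theorem santaloRegion_subset_interior (hK : IsCompact K) (hc : Convex ℝ K)
    (hne : (interior K).Nonempty) (t : ℝ) : santaloRegion K t ⊆ interior K := by
  intro x hx
  by_contra h
  have := hx.2
  rw [volume_polarAt_eq_top hK hc hne h, ENNReal.mul_top (volume_ne_zero_of_interior_nonempty hne),
    ENNReal.top_div_of_ne_top (volume_ball_sq_ne_top n), top_le_iff] at this
  exact ENNReal.ofReal_ne_top this

theorem isClosed_santaloRegion (hK : IsCompact K) (hne : (interior K).Nonempty) (t : ℝ) :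
    IsClosed (santaloRegion K t) := by
  obtain ⟨k, hk, h⟩ := exists_santaloRegion_eq_laplace hK hne
  have : santaloRegion K t = K ∩ {x | laplace K x ≤ ENNReal.ofReal t / ENNReal.ofReal k} := by
    rw [h]
    ext x
    refine and_congr_right fun _ => ?_
    rw [mem_ofPred_eq, ENNReal.le_div_iff_mul_le (by simp [hk]) (by simp), mul_comm]
  rw [this]
  exact hK.isClosed.inter (isClosed_laplace_le hK _)

/-- Santaló regions are the sublevel sets of a smooth strictly convex function. -/
theorem exists_santaloRegion_eq_sublevel (hK : IsCompact K) (hc : Convex ℝ K)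
    (hne : (interior K).Nonempty) :
    ∃ G : EuclideanSpace ℝ (Fin n) → ℝ, ContDiffOn ℝ ∞ G (interior K) ∧
      StrictConvexOn ℝ (interior K) G ∧
      ∀ t, santaloRegion K t = {x | x ∈ interior K ∧ G x ≤ t} := by
  obtain ⟨k, hk, h⟩ := exists_santaloRegion_eq_laplace hK hne
  refine ⟨fun x => k * ∫ y, Real.exp (inner ℝ x y - supportFn K y),
    contDiffOn_const.mul (contDiffOn_integral_exp hK), ?_, fun t => ?_⟩
  · obtain ⟨h1, h2⟩ := strictConvexOn_integral_exp hK hc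
    refine ⟨h1, fun x hx y hy hxy a b ha hb hab => ?_⟩
    have := mul_lt_mul_of_pos_left (h2 hx hy hxy ha hb hab) hk
    simp only [smul_eq_mul] at this ⊢
    linarith
  · have key : ∀ x ∈ interior K, (ENNReal.ofReal k * laplace K x ≤ ENNReal.ofReal t ↔
        k * ∫ y, Real.exp (inner ℝ x y - supportFn K y) ≤ t) := by
      intro x hx
      have hpos := mul_pos hk (integral_exp_inner_sub_supportFn_pos hK hx)
      rw [laplace_eq_ofReal hK hx, ← ENNReal.ofReal_mul hk.le, ENNReal.ofReal_le_ofReal_iff']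
      -- `ENNReal.ofReal` identifies all `t ≤ 0` with 0; positivity of the integral rules out the
      -- spurious alternative.
      exact ⟨fun h => h.resolve_right (not_le.2 hpos), Or.inl⟩
    ext x
    constructor
    · intro hx
      have hi := santaloRegion_subset_interior hK hc hne t hx
      rw [h] at hx
      exact ⟨hi, (key x hi).1 hx.2⟩
    · intro hx
      rw [h]
      exact ⟨interior_subset hx.1, (key x hx.1).2 hx.2⟩

theorem mem_interior_santaloRegion {G : EuclideanSpace ℝ (Fin n) → ℝ}
    (hG : ContinuousOn G (interior K)) {t : ℝ}
    (h : santaloRegion K t = {x | x ∈ interior K ∧ G x ≤ t}) {x : EuclideanSpace ℝ (Fin n)}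
    (hx : x ∈ interior K) (hxt : G x < t) : x ∈ interior (santaloRegion K t) := by
  rw [mem_interior_iff_mem_nhds, h]
  have hn : interior K ∈ nhds x := isOpen_interior.mem_nhds hx
  filter_upwards [hn, (hG.continuousAt hn).eventually (gt_mem_nhds hxt)] with y hy hyt
  exact ⟨hy, hyt.le⟩

theorem strictConvex_santaloRegion (hK : IsCompact K) (hc : Convex ℝ K)
    (hne : (interior K).Nonempty) (t : ℝ) : StrictConvex ℝ (santaloRegion K t) := by
  obtain ⟨G, hs, hG, h⟩ := exists_santaloRegion_eq_sublevel hK hc hne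
  intro x hx y hy hxy a b ha hb hab
  rw [h] at hx hy
  refine mem_interior_santaloRegion hs.continuousOn (h t) (hG.1 hx.1 hy.1 ha.le hb.le hab) ?_
  have := hG.2 hx.1 hy.1 hxy ha hb hab
  simp only [smul_eq_mul] at this
  have h1 := mul_le_mul_of_nonneg_left hx.2 ha.le
  have h2 := mul_le_mul_of_nonneg_left hy.2 hb.le
  have h3 : a * t + b * t = t := by rw [← add_mul, hab, one_mul]
  linarith

theorem smul_add_smul_santaloRegion_subset (hK : IsCompact K) (hc : Convex ℝ K)
    (hne : (interior K).Nonempty) (t s : ℝ) {α : ℝ} (h0 : 0 ≤ α) (h1 : α ≤ 1) :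
    α • santaloRegion K t + (1 - α) • santaloRegion K s ⊆
      santaloRegion K (α * t + (1 - α) * s) := by
  obtain ⟨G, -, hG, h⟩ := exists_santaloRegion_eq_sublevel hK hc hne
  rintro _ ⟨_, ⟨x, hx, rfl⟩, _, ⟨y, hy, rfl⟩, rfl⟩
  rw [h] at hx hy ⊢
  have hα : 0 ≤ 1 - α := sub_nonneg.2 h1
  refine ⟨hG.1 hx.1 hy.1 h0 hα (by ring), ?_⟩
  refine (hG.convexOn.2 hx.1 hy.1 h0 hα (by ring)).trans ?_
  simp only [smul_eq_mul]
  gcongr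
  · exact hx.2
  · exact hy.2

/-- Strict convexity puts the midpoint `m` strictly below `x`. By convexity the difference quotients
from `x` towards `m` are at most `G m - G x < 0`, so their limit cannot be 0. -/
theorem fderiv_ne_zero_of_strictConvexOn {E : Type*} [NormedAddCommGroup E] [NormedSpace ℝ E]
    {U : Set E} {G : E → ℝ} (hG : StrictConvexOn ℝ U G)
    {x y : E} (hd : DifferentiableAt ℝ G x) (hx : x ∈ U) (hy : y ∈ U) (hxy : x ≠ y)
    (hle : G y ≤ G x) : fderiv ℝ G x ≠ 0 := by
  intro h0
  set m := (1 / 2 : ℝ) • x + (1 / 2 : ℝ) • y with hm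
  have hmU : m ∈ U := hG.1 hx hy (by norm_num) (by norm_num) (by norm_num)
  have hlt : G m < G x := by
    have := hG.2 hx hy hxy (show (0 : ℝ) < 1 / 2 by norm_num) (show (0 : ℝ) < 1 / 2 by norm_num)
      (by norm_num)
    simp only [smul_eq_mul] at this
    linarith
  have hder : HasDerivAt (fun s : ℝ => G (x + s • (m - x))) 0 0 := by
    have h1 : HasDerivAt (fun s : ℝ => x + s • (m - x)) (m - x) 0 := by
      simpa using ((hasDerivAt_id (0 : ℝ)).smul_const (m - x)).const_add x
    have h2 : HasFDerivAt G (0 : E →L[ℝ] ℝ) (x + (0 : ℝ) • (m - x)) := by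
      rw [zero_smul, add_zero, ← h0]
      exact hd.hasFDerivAt
    have h3 := h2.comp_hasDerivAt (0 : ℝ) h1
    rwa [zero_apply] at h3
  have hlim := hder.tendsto_slope_zero_right
  have : (0 : ℝ) ≤ G m - G x := by
    refine le_of_tendsto hlim ?_
    filter_upwards [Ioo_mem_nhdsGT (show (0 : ℝ) < 1 by norm_num)] with s hs
    have hconv := hG.convexOn.2 hx hmU (sub_nonneg.2 hs.2.le) hs.1.le (by ring)
    have e : (1 - s) • x + s • m = x + s • (m - x) := by module
    rw [e] at hconv
    simp only [smul_eq_mul, zero_add, zero_smul, add_zero] at hconv ⊢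
    rw [inv_mul_le_iff₀ hs.1]
    linarith
  linarith

/-- Boundary points have `G = t`, since `G < t` is an interior condition. A second point of the
region has `G ≤ t`, which makes the derivative at the boundary point nonzero. -/
theorem hasSmoothBoundary_santaloRegion (hK : IsCompact K) (hc : Convex ℝ K)
    (hne : (interior K).Nonempty) {t : ℝ} (ht : (santaloRegion K t).Nontrivial) :
    HasSmoothBoundary (santaloRegion K t) := by
  obtain ⟨G, hs, hG, h⟩ := exists_santaloRegion_eq_sublevel hK hc hne
  intro x hx
  have hxS : x ∈ santaloRegion K t := (isClosed_santaloRegion hK hne t).frontier_subset hx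
  obtain ⟨y, hyS, hyx⟩ := ht.exists_ne x
  have hx' := hxS
  have hy' := hyS
  rw [h] at hx' hy'
  have hGx : G x = t := by
    refine le_antisymm hx'.2 (not_lt.1 fun hlt => hx.2 ?_)
    exact mem_interior_santaloRegion hs.continuousOn (h t) hx'.1 hlt
  have hd : DifferentiableAt ℝ G x :=
    (hs.differentiableOn (by simp)).differentiableAt (isOpen_interior.mem_nhds hx'.1)
  refine ⟨interior K, fun y => G y - t, isOpen_interior, hx'.1, hs.sub contDiffOn_const,
    by simp [hGx], ?_, ?_⟩
  · rw [fderiv_sub_const]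
    exact fderiv_ne_zero_of_strictConvexOn hG hd hx'.1 hy'.1 hyx.symm (hGx ▸ hy'.2)
  · rw [h]
    ext z
    simp only [mem_inter_iff, mem_ofPred_eq, sub_nonpos]
    tauto

theorem monotone_santaloRegion (K : Set (EuclideanSpace ℝ (Fin n))) :
    Monotone (santaloRegion K) := fun _ _ hst _ hx =>
  ⟨hx.1, hx.2.trans (ENNReal.ofReal_le_ofReal hst)⟩

end Regions

/-! ### Affine equivariance -/

theorem LinearMap.det_adjoint_real {n : ℕ}
    (L : EuclideanSpace ℝ (Fin n) →ₗ[ℝ] EuclideanSpace ℝ (Fin n)) :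
    LinearMap.det (LinearMap.adjoint L) = LinearMap.det L := by
  rw [← LinearMap.det_toMatrix (EuclideanSpace.basisFun (Fin n) ℝ).toBasis,
    LinearMap.toMatrix_adjoint, Matrix.det_conjTranspose, LinearMap.det_toMatrix]
  simp

theorem polarAt_image {n : ℕ} (K : Set (EuclideanSpace ℝ (Fin n))) (x : EuclideanSpace ℝ (Fin n))
    (A : EuclideanSpace ℝ (Fin n) ≃ᵃ[ℝ] EuclideanSpace ℝ (Fin n)) :
    polarAt (A '' K) (A x) =
      LinearMap.adjoint (A.linear : EuclideanSpace ℝ (Fin n) →ₗ[ℝ] EuclideanSpace ℝ (Fin n)) ⁻¹'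
        polarAt K x := by
  ext y
  simp only [polarAt, mem_ofPred_eq, mem_preimage, forall_mem_image]
  refine forall₂_congr fun z _ => ?_
  rw [LinearMap.adjoint_inner_left]
  have : A z - A x = A.linear (z - x) := by
    have := A.toAffineMap.linearMap_vsub z x
    simpa using this.symm
  rw [this]
  rfl

theorem volume_affineEquiv_image {n : ℕ} (K : Set (EuclideanSpace ℝ (Fin n)))
    (A : EuclideanSpace ℝ (Fin n) ≃ᵃ[ℝ] EuclideanSpace ℝ (Fin n)) :
    volume (A '' K) = ENNReal.ofReal |LinearMap.det
      (A.linear : EuclideanSpace ℝ (Fin n) →ₗ[ℝ] EuclideanSpace ℝ (Fin n))| * volume K := by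
  have : A '' K = (fun y => y + A 0) ''
      ((A.linear : EuclideanSpace ℝ (Fin n) →ₗ[ℝ] EuclideanSpace ℝ (Fin n)) '' K) := by
    rw [image_image]
    refine image_congr fun z _ => ?_
    have := A.map_vadd 0 z
    simpa using this
  rw [this, image_add_right, measure_preimage_add_right, Measure.addHaar_image_linearMap]

/-- The volume of the body is multiplied by `|det|` and that of the polar body, transformed by the
inverse adjoint, by `|det|⁻¹`. -/
theorem santaloRegion_image {n : ℕ} (K : Set (EuclideanSpace ℝ (Fin n)))
    (A : EuclideanSpace ℝ (Fin n) ≃ᵃ[ℝ] EuclideanSpace ℝ (Fin n)) (t : ℝ) :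
    santaloRegion (A '' K) t = A '' santaloRegion K t := by
  ext y
  obtain ⟨x, rfl⟩ := A.surjective y
  rw [A.injective.mem_set_image]
  refine and_congr A.injective.mem_set_image ?_
  set d := LinearMap.det
    (A.linear : EuclideanSpace ℝ (Fin n) →ₗ[ℝ] EuclideanSpace ℝ (Fin n)) with hd
  have hd0 : d ≠ 0 := (LinearEquiv.isUnit_det' A.linear).ne_zero
  have e : volume (A '' K) * volume (polarAt (A '' K) (A x)) =
      volume K * volume (polarAt K x) := by
    rw [polarAt_image, Measure.addHaar_preimage_linearMap _ (by
      rw [LinearMap.det_adjoint_real]; exact hd0), LinearMap.det_adjoint_real,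
      volume_affineEquiv_image, ← hd]
    calc _ = (ENNReal.ofReal |d| * ENNReal.ofReal |d⁻¹|) * (volume K * volume (polarAt K x)) := by
          ring
      _ = _ := by
          rw [← ENNReal.ofReal_mul (abs_nonneg _), ← abs_mul, mul_inv_cancel₀ hd0]
          simp
  rw [e]

/-! ### Floating bodies inside Santaló regions -/

section FloatingBody

variable {n : ℕ} {K : Set (EuclideanSpace ℝ (Fin n))}

/-- Some hyperplane orthogonal to `u` cuts off a cap of volume exactly `v`, and `x` does not lie
strictly beyond it. The part of `K` beyond `x` thus contains that cap up to a null hyperplane. -/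
theorem ofReal_le_volume_cap (hK : IsCompact K) {v : ℝ} (hv : ENNReal.ofReal v ≤ volume K)
    {x : EuclideanSpace ℝ (Fin n)} (hx : x ∈ floatingBody K v) {u : EuclideanSpace ℝ (Fin n)}
    (hu : ‖u‖ = 1) : ENNReal.ofReal v ≤ volume (K ∩ {y | inner ℝ x u < inner ℝ y u}) := by
  have hu0 : u ≠ 0 := by
    rintro rfl
    simp at hu
  have hfin : IsFiniteMeasure (volume.restrict K) := ⟨by simpa using hK.measure_lt_top⟩
  obtain ⟨R, hR⟩ := hK.isBounded.exists_norm_le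
  have hRae : ∀ᵐ y ∂(volume.restrict K), ‖y‖ ≤ R := by
    filter_upwards [ae_restrict_mem hK.measurableSet] with y hy using hR y hy
  obtain ⟨a, ha⟩ := exists_measure_halfspace_eq (u := u)
    (fun a => Measure.absolutelyContinuous_of_le Measure.restrict_le_self (volume_inner_eq hu0 a))
    hRae (c := ENNReal.ofReal v) (by simpa using hv)
  have hm : MeasurableSet {y : EuclideanSpace ℝ (Fin n) | a ≤ inner ℝ y u} :=
    measurableSet_le measurable_const (by fun_prop)
  rw [Measure.restrict_apply hm, inter_comm] at ha
  have hxa : inner ℝ x u ≤ a := hx.2 u hu a ha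
  rw [← ha]
  have hsub : K ∩ {y | a ≤ inner ℝ y u} ⊆
      (K ∩ {y | inner ℝ x u < inner ℝ y u}) ∪ {y | inner ℝ y u = inner ℝ x u} := by
    rintro y ⟨hyK, hya⟩
    rcases (hxa.trans hya).lt_or_eq with h | h
    · exact Or.inl ⟨hyK, h⟩
    · exact Or.inr h.symm
  refine (measure_mono hsub).trans ((measure_union_le _ _).trans ?_)
  rw [volume_inner_eq hu0, add_zero]

theorem exists_unit_forall_inner_ne (hn : 1 ≤ n) {S : Set (EuclideanSpace ℝ (Fin n))}
    (hS : Convex ℝ S) (hSc : IsClosed S) {x : EuclideanSpace ℝ (Fin n)} (hx : x ∉ S) :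
    ∃ u : EuclideanSpace ℝ (Fin n), ‖u‖ = 1 ∧ ∀ z ∈ S, inner ℝ z u ≠ inner ℝ x u := by
  -- For an empty set any unit vector serves; its existence needs `n ≥ 1`.
  rcases S.eq_empty_or_nonempty with rfl | ⟨z₀, hz₀⟩
  · exact ⟨EuclideanSpace.single ⟨0, hn⟩ 1, by simp, by simp⟩
  obtain ⟨f, s, hfx, hf⟩ := geometric_hahn_banach_point_closed hS hSc hx
  set v := (InnerProductSpace.toDual ℝ _).symm f with hv
  have hfv : ∀ y, f y = inner ℝ y v := fun y => by
    rw [hv, real_inner_comm, InnerProductSpace.toDual_symm_apply]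
  have hlt : ∀ z ∈ S, inner ℝ x v < inner ℝ z v := fun z hz => by
    rw [← hfv, ← hfv]
    exact hfx.trans (hf z hz)
  have hv0 : v ≠ 0 := by
    intro h
    have := hlt z₀ hz₀
    simp [h] at this
  refine ⟨‖v‖⁻¹ • v, norm_smul_inv_norm hv0, fun z hz h => ?_⟩
  rw [inner_smul_right, inner_smul_right] at h
  exact (hlt z hz).ne' (mul_left_cancel₀ (inv_ne_zero (norm_ne_zero_iff.2 hv0)) h)

theorem volume_product_le_of_cap_le {δ : ℝ} (h0 : 0 < δ) (h1 : δ < 1 / 2)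
    {V P Q γ B : ℝ≥0∞} (hV : V ≠ 0) (hVt : V ≠ ⊤) (hB : B ≠ 0) (hBt : B ≠ ⊤) (hPQ : V = P + Q)
    (hP : ENNReal.ofReal (δ * V.toReal) ≤ P) (hQ : ENNReal.ofReal (δ * V.toReal) ≤ Q)
    (h : 4 * P * Q * γ ≤ V * B) :
    V * γ / B ≤ ENNReal.ofReal (1 / (4 * δ * (1 - δ))) := by
  lift V to NNReal using hVt
  lift B to NNReal using hBt
  have hPt : P ≠ ⊤ := fun hp => by simp [hp] at hPQ
  have hQt : Q ≠ ⊤ := fun hp => by simp [hp] at hPQ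
  lift P to NNReal using hPt
  lift Q to NNReal using hQt
  rw [ENNReal.coe_toReal] at hP hQ
  have hV0 : (0 : ℝ) < V := by
    have : V ≠ 0 := by exact_mod_cast hV
    positivity
  have hB0 : (0 : ℝ) < B := by
    have : B ≠ 0 := by exact_mod_cast hB
    positivity
  have hP' : δ * V ≤ P := Real.toNNReal_le_iff_le_coe.1 (ENNReal.coe_le_coe.1 hP)
  have hQ' : δ * V ≤ Q := Real.toNNReal_le_iff_le_coe.1 (ENNReal.coe_le_coe.1 hQ)
  have hPQ' : (V : ℝ) = P + Q := by exact_mod_cast hPQ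
  have hP0 : (0 : ℝ) < P := lt_of_lt_of_le (by positivity) hP'
  have hQ0 : (0 : ℝ) < Q := lt_of_lt_of_le (by positivity) hQ'
  have hγ : γ ≠ ⊤ := by
    rintro rfl
    have hp : P ≠ 0 := fun hp => by simp [hp] at hP0
    have hq : Q ≠ 0 := fun hq => by simp [hq] at hQ0
    rw [ENNReal.mul_top (by simp [hp, hq]), top_le_iff] at h
    exact ENNReal.mul_ne_top ENNReal.coe_ne_top ENNReal.coe_ne_top h
  lift γ to NNReal using hγ
  have h' : (4 * P * Q * γ : ℝ) ≤ V * B := by exact_mod_cast h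
  have hprod : δ * (1 - δ) * V ^ 2 ≤ P * Q := by
    have e : (Q : ℝ) = V - P := by linarith
    rw [e] at hQ' ⊢
    -- Expanding `(P - δV)(Q - δV) ≥ 0` with `P + Q = V`.
    nlinarith
  have hδ : 0 < 4 * δ * (1 - δ) := mul_pos (by linarith) (by linarith)
  have key : (V * γ / B : ℝ) ≤ 1 / (4 * δ * (1 - δ)) := by
    rw [div_le_div_iff₀ hB0 hδ, one_mul]
    have h2 : 4 * (δ * (1 - δ) * V ^ 2) * γ ≤ V * B :=
      le_trans (by nlinarith [mul_le_mul_of_nonneg_right hprod γ.2]) h'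
    have h3 : (V : ℝ) * (V * γ * (4 * δ * (1 - δ))) ≤ V * B := by
      calc _ = 4 * (δ * (1 - δ) * V ^ 2) * (γ : ℝ) := by ring
        _ ≤ _ := h2
    exact le_of_mul_le_mul_left h3 hV0
  have hB' : B ≠ 0 := by exact_mod_cast hB
  rw [← ENNReal.coe_mul, ← ENNReal.coe_div hB', ← ENNReal.ofReal_coe_nnreal]
  apply ENNReal.ofReal_le_ofReal
  push_cast
  exact key

/-- Otherwise a hyperplane through `x` misses the closed convex region. Applying
`ofReal_le_volume_cap` to `u` and `-u` bounds both parts of `K` from below, and the Meyer–Pajor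
point on this hyperplane then lies in the region. -/
theorem floatingBody_subset_santaloRegion (hn : 1 ≤ n) (hK : IsCompact K) (hc : Convex ℝ K)
    (hne : (interior K).Nonempty) {δ : ℝ} (h0 : 0 < δ) (h1 : δ < 1 / 2) :
    floatingBody K (δ * volume.real K) ⊆ santaloRegion K (1 / (4 * δ * (1 - δ))) := by
  intro x hx
  by_contra hxS
  obtain ⟨u, hu, hne'⟩ := exists_unit_forall_inner_ne hn
    (strictConvex_santaloRegion hK hc hne _).convex (isClosed_santaloRegion hK hne _) hxS
  have hV0 := volume_ne_zero_of_interior_nonempty hne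
  have hVt : volume K ≠ ⊤ := hK.measure_lt_top.ne
  have hVr : 0 < volume.real K := ENNReal.toReal_pos hV0 hVt
  have hle : ENNReal.ofReal (δ * volume.real K) ≤ volume K := by
    refine ENNReal.ofReal_le_of_le_toReal ?_
    change δ * volume.real K ≤ volume.real K
    nlinarith
  have hP := ofReal_le_volume_cap hK hle hx hu
  have hN := ofReal_le_volume_cap hK hle hx (u := -u) (by rwa [norm_neg])
  simp only [inner_neg_right, neg_lt_neg_iff] at hN
  have hpos : ENNReal.ofReal (δ * volume.real K) ≠ 0 := by
    simpa using mul_pos h0 hVr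
  obtain ⟨z, hzK, hzu, hz⟩ := exists_mem_hyperplane_volume_polarAt_le hK hc hu
    (a := inner ℝ x u) (fun h => hpos (le_zero_iff.1 (h ▸ hP)))
    (fun h => hpos (le_zero_iff.1 (h ▸ hN)))
  have hu0 : u ≠ 0 := by
    rintro rfl
    simp at hu
  have hsum : volume K = volume (K ∩ {y | inner ℝ x u < inner ℝ y u}) +
      volume (K ∩ {y | inner ℝ y u < inner ℝ x u}) := by
    have := lintegral_eq_add_of_hyperplane hu0 (inner ℝ x u) (K.indicator 1)
    rw [lintegral_indicator_one hK.measurableSet, lintegral_indicator_one hK.measurableSet,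
      lintegral_indicator_one hK.measurableSet, Measure.restrict_apply hK.measurableSet,
      Measure.restrict_apply hK.measurableSet] at this
    exact this
  exact hne' z ⟨hzK, volume_product_le_of_cap_le h0 h1 hV0 hVt (volume_ball_sq_ne_zero n)
    (volume_ball_sq_ne_top n) hsum hP hN hz⟩ hzu

end FloatingBody

theorem proposition1 (n : ℕ) (hn : 1 ≤ n) (K : ConvexBody (EuclideanSpace ℝ (Fin n)))
    (hK : (interior (K : Set (EuclideanSpace ℝ (Fin n)))).Nonempty) :
    (∀ t : ℝ, StrictConvex ℝ (santaloRegion (K : Set (EuclideanSpace ℝ (Fin n))) t)) ∧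
    (∀ (A : EuclideanSpace ℝ (Fin n) ≃ᵃ[ℝ] EuclideanSpace ℝ (Fin n)) (t : ℝ),
      santaloRegion (A '' (K : Set (EuclideanSpace ℝ (Fin n)))) t =
        A '' santaloRegion (K : Set (EuclideanSpace ℝ (Fin n))) t) ∧
    (∀ t : ℝ, (santaloRegion (K : Set (EuclideanSpace ℝ (Fin n))) t).Nontrivial →
      HasSmoothBoundary (santaloRegion (K : Set (EuclideanSpace ℝ (Fin n))) t)) ∧
    (Monotone (santaloRegion (K : Set (EuclideanSpace ℝ (Fin n)))) ∧
      ∀ t s α : ℝ, 0 ≤ α → α ≤ 1 →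
        α • santaloRegion (K : Set (EuclideanSpace ℝ (Fin n))) t +
            (1 - α) • santaloRegion (K : Set (EuclideanSpace ℝ (Fin n))) s ⊆
          santaloRegion (K : Set (EuclideanSpace ℝ (Fin n))) (α * t + (1 - α) * s)) ∧
    (∀ δ : ℝ, 0 < δ → δ < 1 / 2 →
      floatingBody (K : Set (EuclideanSpace ℝ (Fin n)))
          (δ * volume.real (K : Set (EuclideanSpace ℝ (Fin n)))) ⊆
        santaloRegion (K : Set (EuclideanSpace ℝ (Fin n))) (1 / (4 * δ * (1 - δ)))) := by

  have hc := K.convex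
  have hk := K.isCompact
  exact ⟨strictConvex_santaloRegion hk hc hK, santaloRegion_image _,
    fun _ ht => hasSmoothBoundary_santaloRegion hk hc hK ht,
    ⟨monotone_santaloRegion _, fun t s _ h0 h1 =>
      smul_add_smul_santaloRegion_subset hk hc hK t s h0 h1⟩,
    fun _ h0 h1 => floatingBody_subset_santaloRegion hn hk hc hK h0 h1⟩
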